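/- Let $G$ be a compact Lie group with its Haar probability measure $dx$, and let $C^\infty(G)$ carry its usual test function topology (uniform convergence of all derivatives). Let $A:C^\infty(G)\to C^\infty(G)$ be a continuous linear operator, and let $R_A$ be its right-convolution kernel: for every $x\in G$, $r_x=R_A(x,\cdot)$ is the unique distribution on $G$ with $$Af(x)=\int_G f(y)\,R_A(x,y^{-1}x)\,dy=\int_G f(xz^{-1})\,R_A(x,z)\,dz\qquad\text{for all } f\in C^\infty(G),$$ the integrals being understood in the sense of distributions. For a continuous irreducible unitary representation $\xi:G\to\mathcal U(\mathcal H_\xi)$ on a (finite-dimensional) complex Hilbert space $\mathcal H_\xi$ with $\dim(\xi)=\dim\mathcal H_\xi$, put $$\widehat f(\xi)=\int_G f(y)\,\xi(y)^*\,dy\in\mathrm{End}(\mathcal H_\xi)\quad (f\in C^\infty(G)),\qquad \sigma_A(x,\xi)=\widehat{r_x}(\xi)=\int_G R_A(x,y)\,\xi(y)^*\,dy\in\mathrm{End}(\mathcal H_\xi),$$ the last integral again in the sense of distributions, i.e. $(\sigma_A(x,\xi)u,v)=r_x\big(y\mapsto(\xi(y)^*u,v)\big)$ for all $u,v\in\mathcal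 H_\xi$ (the functions $y\mapsto(\xi(y)^*u,v)$ are smooth). Let $\widehat G$ be the set of unitary equivalence classes $[\xi]$ of such representations. Then, for any choice of one representative $\xi$ from each class, $$Af(x)=\sum_{[\xi]\in\widehat G}\dim(\xi)\,\mathrm{Tr}\big(\xi(x)\,\sigma_A(x,\xi)\,\widehat f(\xi)\big)$$ for every $f\in C^\infty(G)$ and every $x\in G$, the series converging unconditionally. -/

import Mathlib

open scoped ContDiff Manifold Topology
open MeasureTheory Set

universe w

/-! ### Smoothness of continuous finite-dimensional representations

Continuous homomorphisms from a compact Lie group to the units of a Banach algebra are smooth, so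
matrix coefficients of unitary representations are test functions. -/

theorem aestronglyMeasurable_of_continuous {W G : Type*} [NormedAddCommGroup W]
    [TopologicalSpace G] [CompactSpace G] [MeasurableSpace G] [BorelSpace G]
    (μ : Measure G) (f : G → W) (hf : Continuous f) : AEStronglyMeasurable f μ :=
  (hf.stronglyMeasurable_of_hasCompactSupport (HasCompactSupport.of_compactSpace _))
    |>.aestronglyMeasurable

theorem contDiffOn_integral_smul {E V G : Type*} [NormedAddCommGroup E] [NormedSpace ℝ E]
    [FiniteDimensional ℝ E] [NormedAddCommGroup V] [NormedSpace ℝ V]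
    [TopologicalSpace G] [CompactSpace G] [MeasurableSpace G] [BorelSpace G]
    (μ : Measure G) [IsFiniteMeasure μ] (g : E → G → V) (U : Set E) (hU : IsOpen U)
    (h1 : ∀ y, ContDiffOn ℝ ∞ (fun x => g x y) U)
    (h2 : ∀ k : ℕ, ContinuousOn (fun p : E × G => iteratedFDeriv ℝ k (fun x => g x p.2) p.1)
      (U ×ˢ univ)) :
    ContDiffOn ℝ ∞ (fun x => ∫ y, g x y ∂μ) U := by
  have hcont : ∀ (k : ℕ), ∀ x ∈ U,
      Continuous (fun y => iteratedFDeriv ℝ k (fun x => g x y) x) := by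
    intro k x hx
    exact (h2 k).comp_continuous (f := fun y => (x, y)) (by fun_prop) (fun y => ⟨hx, mem_univ _⟩)
  have hmeas : ∀ (k : ℕ), ∀ x ∈ U,
      AEStronglyMeasurable (fun y => iteratedFDeriv ℝ k (fun x => g x y) x) μ := fun k x hx =>
    (hcont k x hx).stronglyMeasurable_of_hasCompactSupport (HasCompactSupport.of_compactSpace _)
    |>.aestronglyMeasurable
  have hbound : ∀ (k : ℕ), ∀ x ∈ U, ∃ C : ℝ, ∀ᶠ z in 𝓝 x, ∀ y,
      ‖iteratedFDeriv ℝ k (fun x => g x y) z‖ ≤ C := by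
    intro k x hx
    obtain ⟨r, hr, hrU⟩ := Metric.nhds_basis_closedBall.mem_iff.1 (hU.mem_nhds hx)
    obtain ⟨C, hC⟩ := ((isCompact_closedBall x r).prod isCompact_univ).exists_bound_of_continuousOn
      ((h2 k).mono (prod_mono hrU (subset_univ _)))
    refine ⟨C, ?_⟩
    filter_upwards [Metric.closedBall_mem_nhds x hr] with z hz y
    exact hC (z, y) ⟨hz, mem_univ _⟩
  have hint : ∀ (k : ℕ), ∀ x ∈ U,
      Integrable (fun y => iteratedFDeriv ℝ k (fun x => g x y) x) μ := by
    intro k x hx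
    obtain ⟨C, hC⟩ := hbound k x hx
    exact Integrable.of_bound (hmeas k x hx) C (.of_forall hC.self_of_nhds)
  have key : ∀ (k : ℕ), ∀ x ∈ U,
      HasFDerivAt (fun x => ∫ y, iteratedFDeriv ℝ k (fun x => g x y) x ∂μ)
        (∫ y, iteratedFDeriv ℝ (k + 1) (fun x => g x y) x ∂μ).curryLeft x := by
    intro k x hx
    obtain ⟨C, hC⟩ := hbound (k + 1) x hx
    have hmem : ∀ᶠ z in 𝓝 x, z ∈ U := hU.mem_nhds hx
    have e : (∫ y, iteratedFDeriv ℝ (k + 1) (fun x => g x y) x ∂μ).curryLeft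
        = ∫ y, (iteratedFDeriv ℝ (k + 1) (fun x => g x y) x).curryLeft ∂μ := by
      let L : (E [×(k+1)]→L[ℝ] V) ≃L[ℝ] (E →L[ℝ] (E [×k]→L[ℝ] V)) :=
        (continuousMultilinearCurryLeftEquiv ℝ (fun _ : Fin (k+1) => E) V).toContinuousLinearEquiv
      exact (ContinuousLinearEquiv.integral_comp_comm (𝕜 := ℝ) (E := E [×(k+1)]→L[ℝ] V)
        (F := E →L[ℝ] (E [×k]→L[ℝ] V)) (μ := μ) L
        (fun y => iteratedFDeriv ℝ (k + 1) (fun x => g x y) x)).symm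
    rw [e]
    refine hasFDerivAt_integral_of_dominated_of_fderiv_le (bound := fun _ => C)
      (F' := fun z y => (iteratedFDeriv ℝ (k + 1) (fun x => g x y) z).curryLeft)
      (hC.and hmem) ?_ (hint k x hx) ?_ ?_ (integrable_const C) ?_
    · filter_upwards [hmem] with z hz using hmeas k z hz
    · exact aestronglyMeasurable_of_continuous (W := E →L[ℝ] E [×k]→L[ℝ] V) μ _
        ((continuousMultilinearCurryLeftEquiv ℝ (fun _ : Fin (k+1) => E) V).continuous.comp
          (hcont (k+1) x hx))
    · refine .of_forall fun y z hz => ?_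
      rw [ContinuousMultilinearMap.curryLeft_norm]
      exact hz.1 y
    · refine .of_forall fun y z hz => ?_
      have hd : ContDiffAt ℝ ∞ (fun x => g x y) z := (h1 y).contDiffAt (hU.mem_nhds hz.2)
      have := (hd.differentiableAt_iteratedFDeriv (m := k) (by exact_mod_cast ENat.natCast_lt_top k)).hasFDerivAt
      rw [fderiv_iteratedFDeriv] at this
      exact this
  refine HasFTaylorSeriesUpToOn.contDiffOn (n := ⊤)
    (f' := fun x k => ∫ y, iteratedFDeriv ℝ k (fun x => g x y) x ∂μ) ⟨?_, ?_, ?_⟩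
  · intro x hx
    exact ((continuousMultilinearCurryFin0 ℝ E V).toContinuousLinearEquiv.integral_comp_comm
        _).symm
  · intro k _ x hx
    exact (key k x hx).hasFDerivWithinAt
  · intro k _ x hx
    exact (key k x hx).continuousAt.continuousWithinAt

theorem iteratedFDeriv_prodMk_right {E W : Type*} [NormedAddCommGroup E] [NormedSpace ℝ E]
    [NormedAddCommGroup W] [NormedSpace ℝ W] (F : E × E → W) (D : Set (E × E)) (hD : IsOpen D)
    (hF : ContDiffOn ℝ ∞ F D) (k : ℕ) (x w : E) (hx : (x, w) ∈ D) :
    iteratedFDeriv ℝ k (fun x => F (x, w)) x =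
      (iteratedFDeriv ℝ k F (x, w)).compContinuousLinearMap
        fun _ => ContinuousLinearMap.inl ℝ E E := by
  have hk : (k : WithTop ℕ∞) ≤ ∞ := by exact_mod_cast le_top
  set a : E × E := (0, w)
  set S : Set (E × E) := (fun q => q + a) ⁻¹' D
  have hS : IsOpen S := hD.preimage (by fun_prop)
  have hF' : ContDiffOn ℝ ∞ (fun q => F (q + a)) S :=
    hF.comp (by fun_prop) (mapsTo_preimage _ _)
  have hT : IsOpen (ContinuousLinearMap.inl ℝ E E ⁻¹' S) := hS.preimage (by fun_prop)
  have hxS : ContinuousLinearMap.inl ℝ E E x ∈ S := by simpa [S, a] using hx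
  have := (ContinuousLinearMap.inl ℝ E E).iteratedFDerivWithin_comp_right hF' hS.uniqueDiffOn
    hT.uniqueDiffOn hxS hk
  rw [iteratedFDerivWithin_of_isOpen k hT hxS, iteratedFDerivWithin_of_isOpen k hS hxS,
    iteratedFDeriv_comp_add_right] at this
  simpa [Function.comp_def, a] using this

section
variable {E H G : Type*} [NormedAddCommGroup E] [NormedSpace ℝ E]
    [TopologicalSpace H] (I : ModelWithCorners ℝ E H) [I.Boundaryless]
    [TopologicalSpace G] [ChartedSpace H G] [IsManifold I ∞ G]

theorem continuousOn_iteratedFDeriv_of_contMDiffOn {V : Type*}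
    [NormedAddCommGroup V] [NormedSpace ℝ V] (φ : E → G → ℝ) (U : Set E) (hU : IsOpen U)
    (hφ : ContMDiffOn (𝓘(ℝ, E).prod I) 𝓘(ℝ, ℝ) ∞ (Function.uncurry φ) (U ×ˢ univ))
    (ρ : G → V) (hρ : Continuous ρ) (k : ℕ) :
    ContinuousOn (fun p : E × G => iteratedFDeriv ℝ k (fun x => φ x p.2 • ρ p.2) p.1)
      (U ×ˢ univ) := by
  have hk : (k : WithTop ℕ∞) ≤ ∞ := by exact_mod_cast le_top
  rintro ⟨x₀, y₀⟩ ⟨hx₀, -⟩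
  apply ContinuousAt.continuousWithinAt
  set d := extChartAt I y₀
  set F : E × E → ℝ := fun q => φ q.1 (d.symm q.2)
  set D : Set (E × E) := U ×ˢ d.target
  have hD : IsOpen D := hU.prod (isOpen_extChartAt_target y₀)
  have hF : ContDiffOn ℝ ∞ F D := by
    rw [← contMDiffOn_iff_contDiffOn]
    have h1 : ContMDiffOn 𝓘(ℝ, E × E) (𝓘(ℝ, E).prod I) ∞
        (fun q : E × E => (q.1, d.symm q.2)) D := by
      refine ContMDiffOn.prodMk ?_ ?_
      · exact (contMDiff_iff_contDiff.2 contDiff_fst).contMDiffOn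
      · exact (contMDiffOn_extChartAt_symm (I := I) (n := ∞) y₀).comp
          (contMDiff_iff_contDiff.2 contDiff_snd).contMDiffOn (fun q hq => hq.2)
    exact hφ.comp h1 (fun q hq => ⟨hq.1, mem_univ _⟩)
  have hsrc : ∀ᶠ p : E × G in 𝓝 (x₀, y₀), p.1 ∈ U ∧ p.2 ∈ d.source := by
    have h1 : ∀ᶠ p : E × G in 𝓝 (x₀, y₀), p.1 ∈ U :=
      continuous_fst.continuousAt.eventually (hU.mem_nhds hx₀)
    have h2 : ∀ᶠ p : E × G in 𝓝 (x₀, y₀), p.2 ∈ d.source :=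
      continuous_snd.continuousAt.eventually (extChartAt_source_mem_nhds (I := I) y₀)
    exact h1.and h2
  have heq : (fun p : E × G => iteratedFDeriv ℝ k (fun x => φ x p.2 • ρ p.2) p.1) =ᶠ[𝓝 (x₀, y₀)]
      fun p => ((ContinuousLinearMap.toSpanSingleton ℝ (ρ p.2)).compContinuousMultilinearMap
        ((iteratedFDeriv ℝ k F (p.1, d p.2)).compContinuousLinearMap
        fun _ => ContinuousLinearMap.inl ℝ E E)) := by
    filter_upwards [hsrc] with p hp
    have hmem : (p.1, d p.2) ∈ D := ⟨hp.1, d.map_source hp.2⟩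
    rw [← iteratedFDeriv_prodMk_right F D hD hF k _ _ hmem]
    have e1 : ∀ x, F (x, d p.2) = φ x p.2 := fun x => by simp [F, d.left_inv hp.2]
    simp only [e1]
    have hc : ContDiffAt ℝ ∞ (fun x => φ x p.2) p.1 := by
      have : ContDiffAt ℝ ∞ F (p.1, d p.2) := hF.contDiffAt (hD.mem_nhds hmem)
      have := ContDiffAt.comp p.1 this (f := fun x => (x, d p.2)) (by fun_prop)
      simpa only [Function.comp_def, e1] using this
    exact (ContinuousLinearMap.toSpanSingleton ℝ (ρ p.2)).iteratedFDeriv_comp_left hc hk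
  refine ContinuousAt.congr ?_ heq.symm
  have hd : ContinuousAt (fun p : E × G => (p.1, d p.2)) (x₀, y₀) :=
    continuousAt_fst.prodMk ((continuousAt_extChartAt (I := I) y₀).comp continuousAt_snd)
  have hmem : (x₀, d y₀) ∈ D := ⟨hx₀, mem_extChartAt_target (I := I) y₀⟩
  have hFc : ContinuousAt (iteratedFDeriv ℝ k F) (x₀, d y₀) := by
    have := (hF.continuousOn_iteratedFDerivWithin hk hD.uniqueDiffOn)
    exact (this.congr (fun q hq => (iteratedFDerivWithin_of_isOpen k hD hq).symm)).continuousAt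
      (hD.mem_nhds hmem)
  have h1 : ContinuousAt (fun p : E × G => (iteratedFDeriv ℝ k F (p.1, d p.2)).compContinuousLinearMap
        fun _ => ContinuousLinearMap.inl ℝ E E) (x₀, y₀) :=
    (ContinuousMultilinearMap.compContinuousLinearMapL (ι := Fin k) (F := ℝ)
      (fun _ => ContinuousLinearMap.inl ℝ E E)).continuous.continuousAt.comp
      (ContinuousAt.comp (f := fun p : E × G => (p.1, d p.2)) hFc hd)
  have h2 : ContinuousAt (fun p : E × G => ContinuousLinearMap.toSpanSingleton ℝ (ρ p.2))
      (x₀, y₀) := by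
    have : Continuous fun p : E × G => ContinuousLinearMap.toSpanSingleton ℝ (ρ p.2) :=
      (ContinuousLinearMap.toSpanSingletonLIE ℝ V).continuous.comp (hρ.comp continuous_snd)
    exact this.continuousAt
  have h3 := ((ContinuousLinearMap.compContinuousMultilinearMapL ℝ (fun _ : Fin k => E) ℝ V
    ).continuous.continuousAt.comp h2).clm_apply h1
  exact h3

end

theorem contMDiff_integral_translate {E H G : Type*} [NormedAddCommGroup E] [NormedSpace ℝ E]
    [FiniteDimensional ℝ E] [TopologicalSpace H] (I : ModelWithCorners ℝ E H) [I.Boundaryless]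
    [TopologicalSpace G] [ChartedSpace H G] [Group G] [LieGroup I ∞ G] [CompactSpace G]
    [MeasurableSpace G] [BorelSpace G] (μ : Measure G)
    [IsFiniteMeasure μ] {V : Type*} [NormedAddCommGroup V] [NormedSpace ℝ V]
    (φ : G → ℝ) (hφ : ContMDiff I 𝓘(ℝ, ℝ) ∞ φ) (ρ : G → V) (hρ : Continuous ρ) :
    ContMDiff I 𝓘(ℝ, V) ∞ (fun x => ∫ y, φ (x⁻¹ * y) • ρ y ∂μ) := by
  intro x₀
  rw [contMDiffAt_iff_source (I := I), I.range_eq_univ, contMDiffWithinAt_univ,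
    contMDiffAt_iff_contDiffAt]
  have hU := isOpen_extChartAt_target (I := I) x₀
  set c := extChartAt I x₀
  have hj : ContMDiffOn (𝓘(ℝ, E).prod I) 𝓘(ℝ, ℝ) ∞
      (Function.uncurry fun (x : E) (y : G) => φ ((c.symm x)⁻¹ * y)) (c.target ×ˢ univ) := by
    refine hφ.comp_contMDiffOn ?_
    have h1 : ContMDiffOn (𝓘(ℝ, E).prod I) I ∞ (fun p : E × G => c.symm p.1)
        (c.target ×ˢ univ) :=
      (contMDiffOn_extChartAt_symm (I := I) (n := ∞) x₀).comp contMDiff_fst.contMDiffOn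
        (fun q hq => hq.1)
    exact h1.inv.mul contMDiff_snd.contMDiffOn
  have := contDiffOn_integral_smul μ (fun (x : E) (y : G) => φ ((c.symm x)⁻¹ * y) • ρ y)
    c.target hU (fun y => ?_)
    (fun k => continuousOn_iteratedFDeriv_of_contMDiffOn I _ _ hU hj ρ hρ k)
  · exact this.contDiffAt (hU.mem_nhds (mem_extChartAt_target x₀))
  · refine ContDiffOn.smul ?_ contDiffOn_const
    rw [← contMDiffOn_iff_contDiffOn]
    exact hj.comp (f := fun x : E => (x, y)) (contMDiff_id.prodMk contMDiff_const).contMDiffOn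
      (fun x hx => ⟨hx, mem_univ _⟩)


theorem contMDiff_of_continuous_monoidHom {E H G : Type*} [NormedAddCommGroup E] [NormedSpace ℝ E]
    [FiniteDimensional ℝ E] [TopologicalSpace H] (I : ModelWithCorners ℝ E H) [I.Boundaryless]
    [TopologicalSpace G] [ChartedSpace H G] [Group G] [LieGroup I ∞ G] [CompactSpace G] [T2Space G]
    {A : Type*} [NormedRing A] [NormedAlgebra ℝ A] [CompleteSpace A]
    (ρ : G →* A) (hρ : Continuous ρ) : ContMDiff I 𝓘(ℝ, A) ∞ ρ := by
  let _ : MeasurableSpace G := borel G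
  have : BorelSpace G := ⟨rfl⟩
  have : IsTopologicalGroup G := topologicalGroup_of_lieGroup I ∞
  let μ : Measure G := Measure.haar
  -- a smooth bump function concentrated where `ρ` is close to `1`
  have hnhds : {y : G | ‖ρ y - 1‖ < 1 / 2} ∈ 𝓝 (1 : G) := by
    have : Continuous fun y => ‖ρ y - 1‖ := by fun_prop
    exact this.continuousAt.eventually_lt continuousAt_const (by simp)
  obtain ⟨φ, -, hφ⟩ := (SmoothBumpFunction.nhds_basis_support (I := I) hnhds).mem_iff.1 hnhds
  have hφc : Continuous φ := φ.continuous
  have hint : Integrable (fun y => φ y) μ := hφc.integrable_of_hasCompactSupport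
    (HasCompactSupport.of_compactSpace _)
  have hint2 : Integrable (fun y => φ y • (ρ y - 1)) μ :=
    (show Continuous fun y => φ y • (ρ y - 1) by fun_prop).integrable_of_hasCompactSupport
    (HasCompactSupport.of_compactSpace _)
  have hint3 : Integrable (fun y => φ y • ρ y) μ :=
    (show Continuous fun y => φ y • ρ y by fun_prop).integrable_of_hasCompactSupport
    (HasCompactSupport.of_compactSpace _)
  set c : ℝ := ∫ y, φ y ∂μ
  have hc : 0 < c := hφc.integral_pos_of_hasCompactSupport_nonneg_nonzero
    (HasCompactSupport.of_compactSpace _) (fun y => φ.nonneg) (x := 1) (by simp)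
  set B : A := ∫ y, φ y • ρ y ∂μ
  have hB : ‖B - c • (1 : A)‖ ≤ c * (1 / 2) := by
    have e : B - c • (1 : A) = ∫ y, φ y • (ρ y - 1) ∂μ := by
      simp_rw [smul_sub]
      rw [integral_sub hint3 (hint.smul_const _), integral_smul_const]
    rw [e]
    calc ‖∫ y, φ y • (ρ y - 1) ∂μ‖ ≤ ∫ y, φ y * (1 / 2) ∂μ := by
          refine norm_integral_le_of_norm_le (hint.mul_const _) (.of_forall fun y => ?_)
          rw [norm_smul, Real.norm_of_nonneg φ.nonneg]
          by_cases hy : φ y = 0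
          · simp [hy]
          · exact mul_le_mul_of_nonneg_left (le_of_lt (hφ hy)) φ.nonneg
      _ = c * (1 / 2) := integral_mul_const _ _
  have hunit : IsUnit B := by
    have h1 : ‖1 - c⁻¹ • B‖ < 1 := by
      have : (1 : A) - c⁻¹ • B = -(c⁻¹ • (B - c • (1 : A))) := by
        rw [smul_sub, smul_smul, inv_mul_cancel₀ hc.ne', one_smul]; abel
      rw [this, norm_neg, norm_smul, Real.norm_of_nonneg (inv_nonneg.2 hc.le)]
      calc c⁻¹ * ‖B - c • (1 : A)‖ ≤ c⁻¹ * (c * (1 / 2)) := by gcongr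
        _ = 1 / 2 := by field_simp
        _ < 1 := by norm_num
    have h2 : IsUnit (c⁻¹ • B) := by
      have := isUnit_one_sub_of_norm_lt_one h1
      simpa using this
    have h3 : B = (algebraMap ℝ A c) * (c⁻¹ • B) := by
      rw [← Algebra.smul_def, smul_smul, mul_inv_cancel₀ hc.ne', one_smul]
    rw [h3]
    exact ((isUnit_iff_ne_zero.2 hc.ne').map (algebraMap ℝ A)).mul h2
  obtain ⟨b, hb⟩ := hunit
  have key : ∀ x, ρ x = (∫ y, φ (x⁻¹ * y) • ρ y ∂μ) * (↑b⁻¹ : A) := by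
    intro x
    have e1 : ∫ y, φ (x⁻¹ * y) • ρ y ∂μ = ∫ y, φ y • ρ (x * y) ∂μ := by
      rw [← integral_mul_left_eq_self (fun y => φ (x⁻¹ * y) • ρ y) x]
      simp
    have e2 : ∫ y, φ y • ρ (x * y) ∂μ = ρ x * B := by
      simp_rw [map_mul, ← mul_smul_comm]
      exact integral_const_mul_of_integrable hint3
    rw [e1, e2, ← hb, mul_assoc, Units.mul_inv, mul_one]
  have hs := contMDiff_integral_translate I μ φ φ.contMDiff ρ hρ
  have : (ρ : G → A) = fun x => (ContinuousLinearMap.mul ℝ A).flip (↑b⁻¹ : A)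
      (∫ y, φ (x⁻¹ * y) • ρ y ∂μ) := by
    funext x; rw [key x]; rfl
  rw [this]
  exact (ContinuousLinearMap.contMDiff _).comp hs

/-! ### Test functions and distributions on a compact manifold -/

section TestFunctions

variable {E H M : Type*} [NormedAddCommGroup E] [NormedSpace ℝ E] [TopologicalSpace H]
  (I : ModelWithCorners ℝ E H) (M) [TopologicalSpace M] [ChartedSpace H M]

/-- The space `C^∞(M)` of smooth complex-valued functions on a real manifold `M`. -/
abbrev SmoothFunction := C^∞⟮I, M; 𝓘(ℝ, ℂ), ℂ⟯

/-- Smooth vector fields on `M`. -/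
abbrev SmoothVectorField [IsManifold I ∞ M] :=
  Cₛ^∞⟮I; E, (TangentSpace I : M → Type _)⟯

variable {I M}

noncomputable instance : SMul ℂ (SmoothFunction I M) :=
  ⟨fun c f => ⟨fun x => c * f x,
    (ContinuousLinearMap.mul ℝ ℂ c).contMDiff.comp f.contMDiff⟩⟩

@[simp] theorem SmoothFunction.smul_apply (c : ℂ) (f : SmoothFunction I M) (x : M) :
    (c • f) x = c * f x := rfl

/-- `C^∞(M)` as a complex vector space, with pointwise operations. -/
noncomputable instance : Module ℂ (SmoothFunction I M) :=
  Function.Injective.module ℂ (ContMDiffMap.coeFnAddMonoidHom (I := I) (n := ∞))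
    ContMDiffMap.coe_injective (fun _ _ => rfl)

/-- The derivative `X f` of a function along a vector field. -/
noncomputable def derivAlong [IsManifold I ∞ M] (X : SmoothVectorField I M) (f : M → ℂ) : M → ℂ :=
  fun x => mfderiv I 𝓘(ℝ, ℂ) f x (X x)

/-- The iterated derivative `X₁ X₂ ⋯ X_k f` along a finite list of vector fields. -/
noncomputable def iterDerivAlong [IsManifold I ∞ M] (L : List (SmoothVectorField I M)) (f : M → ℂ) :
    M → ℂ :=
  L.foldr derivAlong f

/-- The usual test function topology of `C^∞(M)`, for `M` compact: uniform convergence of the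
functions together with all their iterated derivatives along smooth vector fields. -/
noncomputable instance [IsManifold I ∞ M] : TopologicalSpace (SmoothFunction I M) :=
  ⨅ L : List (SmoothVectorField I M),
    TopologicalSpace.induced (fun f => UniformFun.ofFun (iterDerivAlong L f))
      (inferInstance : TopologicalSpace (UniformFun M ℂ))

/-- Distributions on a compact manifold: continuous linear functionals on `C^∞(M)`. -/
abbrev SmoothDistribution (I : ModelWithCorners ℝ E H) (M : Type*) [TopologicalSpace M]
    [ChartedSpace H M] [IsManifold I ∞ M] :=
  SmoothFunction I M →L[ℂ] ℂ

theorem contMDiff_derivAlong [IsManifold I ∞ M] (X : SmoothVectorField I M) {f : M → ℂ}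
    (hf : ContMDiff I 𝓘(ℝ, ℂ) ∞ f) : ContMDiff I 𝓘(ℝ, ℂ) ∞ (derivAlong X f) := by
  have h1 := (hf.contMDiff_tangentMap (m := ∞) (by simp)).comp X.contMDiff
  exact (contMDiff_snd_tangentBundle_modelSpace ℂ 𝓘(ℝ, ℂ)).comp h1

theorem contMDiff_iterDerivAlong [IsManifold I ∞ M] (L : List (SmoothVectorField I M)) {f : M → ℂ}
    (hf : ContMDiff I 𝓘(ℝ, ℂ) ∞ f) : ContMDiff I 𝓘(ℝ, ℂ) ∞ (iterDerivAlong L f) := by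
  induction L with
  | nil => exact hf
  | cons X L ih => exact contMDiff_derivAlong X ih

/-- Transport of a vector field by a diffeomorphism. -/
theorem exists_derivAlong_comp [CompleteSpace E] [IsManifold I ∞ M] (ψ : M ≃ₘ^∞⟮I, I⟯ M)
    (X : SmoothVectorField I M) :
    ∃ Y : SmoothVectorField I M, ∀ f : M → ℂ, ContMDiff I 𝓘(ℝ, ℂ) ∞ f →
      derivAlong X (f ∘ ψ) = derivAlong Y f ∘ ψ := by
  have : IsManifold I 1 M := IsManifold.of_le (n := ∞) (by simp)
  have h0 : (∞ : WithTop ℕ∞) ≠ 0 := by simp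
  refine ⟨⟨VectorField.mpullback I I ψ.symm X, ?_⟩, ?_⟩
  · refine X.contMDiff.mpullback_vectorField (n := ∞) ψ.symm.contMDiff (fun x => ?_) (by simp)
    rw [← Diffeomorph.mfderivToContinuousLinearEquiv_coe ψ.symm h0]
    exact ContinuousLinearMap.isInvertible_equiv
  · intro f hf
    funext x
    have hψ : MDifferentiableAt I I ψ x := ψ.contMDiff.mdifferentiableAt h0
    have hψ' : MDifferentiableAt I I ψ.symm (ψ x) := ψ.symm.contMDiff.mdifferentiableAt h0
    have hfx : MDifferentiableAt I 𝓘(ℝ, ℂ) f (ψ x) := hf.mdifferentiableAt h0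
    have e1 : mfderiv I 𝓘(ℝ, ℂ) (f ∘ ψ) x = (mfderiv I 𝓘(ℝ, ℂ) f (ψ x)).comp (mfderiv I I ψ x) :=
      mfderiv_comp x hfx hψ
    have e2 : mfderiv I I ψ.symm (ψ x) (mfderiv I I ψ x (X x)) = X x := by
      have h := mfderiv_comp x hψ' hψ
      have hid : (ψ.symm ∘ ψ : M → M) = id := by funext z; simp
      rw [hid, mfderiv_id] at h
      exact (congrArg (fun T => T (X x)) h).symm
    have e3 : (mfderiv I I ψ.symm (ψ x)).inverse (X (ψ.symm (ψ x))) = mfderiv I I ψ x (X x) := by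
      have hX : (X (ψ.symm (ψ x)) : E) = X x := by rw [ψ.symm_apply_apply]
      have hinv := ContinuousLinearMap.isInvertible_equiv
        (f := ψ.symm.mfderivToContinuousLinearEquiv h0 (x := ψ x))
      rw [Diffeomorph.mfderivToContinuousLinearEquiv_coe ψ.symm h0] at hinv
      exact hinv.inverse_apply_eq.2 (hX.trans e2.symm)
    change mfderiv I 𝓘(ℝ, ℂ) (f ∘ ψ) x (X x) = mfderiv I 𝓘(ℝ, ℂ) f (ψ x) _
    rw [e1]
    exact congrArg (mfderiv I 𝓘(ℝ, ℂ) f (ψ x)) e3.symm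

theorem exists_iterDerivAlong_comp [CompleteSpace E] [IsManifold I ∞ M] (ψ : M ≃ₘ^∞⟮I, I⟯ M)
    (L : List (SmoothVectorField I M)) :
    ∃ L' : List (SmoothVectorField I M), ∀ f : M → ℂ, ContMDiff I 𝓘(ℝ, ℂ) ∞ f →
      iterDerivAlong L (f ∘ ψ) = iterDerivAlong L' f ∘ ψ := by
  induction L with
  | nil => exact ⟨[], fun f _ => rfl⟩
  | cons X L ih =>
    obtain ⟨L', hL'⟩ := ih
    obtain ⟨Y, hY⟩ := exists_derivAlong_comp ψ X
    refine ⟨Y :: L', fun f hf => ?_⟩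
    change derivAlong X (iterDerivAlong L (f ∘ ψ)) = derivAlong Y (iterDerivAlong L' f) ∘ ψ
    rw [hL' f hf, hY _ (contMDiff_iterDerivAlong L' hf)]

/-- The pullback `f ↦ f ∘ ψ` by a diffeomorphism, as a continuous linear map of `C^∞(M)`. -/
noncomputable def SmoothFunction.compDiffeo [CompleteSpace E] [IsManifold I ∞ M]
    (ψ : M ≃ₘ^∞⟮I, I⟯ M) : SmoothFunction I M →L[ℂ] SmoothFunction I M where
  toFun f := ⟨fun x => f (ψ x), f.contMDiff.comp ψ.contMDiff⟩
  map_add' _ _ := rfl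
  map_smul' _ _ := rfl
  cont := by
    refine continuous_iInf_rng.2 fun L => continuous_induced_rng.2 ?_
    obtain ⟨L', hL'⟩ := exists_iterDerivAlong_comp ψ L
    have h1 : Continuous fun f : SmoothFunction I M => UniformFun.ofFun (iterDerivAlong L' f) :=
      continuous_iInf_dom (i := L') continuous_induced_dom
    have h2 := (UniformFun.precomp_uniformContinuous (β := ℂ) (f := (ψ : M → M))).continuous.comp h1
    refine h2.congr fun f => ?_
    exact congrArg UniformFun.ofFun (hL' f f.contMDiff).symm

@[simp] theorem SmoothFunction.compDiffeo_apply [CompleteSpace E] [IsManifold I ∞ M]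
    (ψ : M ≃ₘ^∞⟮I, I⟯ M) (f : SmoothFunction I M) (x : M) : compDiffeo ψ f x = f (ψ x) := rfl

/-- The Dirac distribution `f ↦ f x`. -/
noncomputable def diracDistribution [IsManifold I ∞ M] (x : M) : SmoothDistribution I M where
  toFun f := f x
  map_add' _ _ := rfl
  map_smul' _ _ := rfl
  cont := by
    have h1 : Continuous fun f : SmoothFunction I M => UniformFun.ofFun (iterDerivAlong [] f) :=
      continuous_iInf_dom (i := []) continuous_induced_dom
    exact (UniformFun.uniformContinuous_eval ℂ x).continuous.comp h1

end TestFunctions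

/-! ### Unitary representations and the unitary dual -/

section UnitaryDual

/-- A (strongly) continuous irreducible unitary representation of a topological group `G` on a
finite-dimensional complex Hilbert space. -/
structure UnitaryIrrep (G : Type*) [Group G] [TopologicalSpace G] where
  space : Type w
  [normedAddCommGroup : NormedAddCommGroup space]
  [innerProductSpace : InnerProductSpace ℂ space]
  [finiteDimensional : FiniteDimensional ℂ space]
  rep : Representation ℂ G space
  continuous_rep : ∀ v : space, Continuous fun x => rep x v
  inner_rep : ∀ (x : G) (u v : space), inner ℂ (rep x u) (rep x v) = inner ℂ u v
  irreducible : rep.IsIrreducible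

attribute [instance] UnitaryIrrep.normedAddCommGroup UnitaryIrrep.innerProductSpace
  UnitaryIrrep.finiteDimensional

variable {G : Type*} [Group G] [TopologicalSpace G]

instance (ξ : UnitaryIrrep.{w} G) : CompleteSpace ξ.space := FiniteDimensional.complete ℂ _

/-- `dim(ξ)`. -/
noncomputable def UnitaryIrrep.dim (ξ : UnitaryIrrep.{w} G) : ℕ := Module.finrank ℂ ξ.space

/-- The operator `ξ(x)`, as a continuous linear map. -/
noncomputable def UnitaryIrrep.op (ξ : UnitaryIrrep.{w} G) : G →* (ξ.space →L[ℂ] ξ.space) where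
  toFun x := LinearMap.toContinuousLinearMap (ξ.rep x)
  map_one' := by ext; simp
  map_mul' _ _ := by ext; simp

theorem UnitaryIrrep.continuous_op (ξ : UnitaryIrrep.{w} G) : Continuous ξ.op := by
  refine continuous_clm_apply.2 ξ.continuous_rep

/-- Two unitary representations are equivalent if there is a unitary intertwining operator between
them. -/
instance UnitaryIrrep.setoid (G : Type*) [Group G] [TopologicalSpace G] :
    Setoid (UnitaryIrrep.{w} G) where
  r ξ η := ∃ U : ξ.space ≃ₗᵢ[ℂ] η.space, ∀ (x : G) (v : ξ.space), U (ξ.rep x v) = η.rep x (U v)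
  iseqv :=
    { refl := fun ξ => ⟨LinearIsometryEquiv.refl ℂ _, fun _ _ => rfl⟩
      symm := by
        rintro ξ η ⟨U, hU⟩
        refine ⟨U.symm, fun x v => ?_⟩
        rw [LinearIsometryEquiv.symm_apply_eq, hU, U.apply_symm_apply]
      trans := by
        rintro ξ η ζ ⟨U, hU⟩ ⟨V, hV⟩
        exact ⟨U.trans V, fun x v => by simp [hU, hV]⟩ }

/-- The unitary dual `Ĝ`: the set of equivalence classes of irreducible unitary representations. -/
def UnitaryDual (G : Type*) [Group G] [TopologicalSpace G] :=
  Quotient (UnitaryIrrep.setoid.{w} G)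

/-- The class `[ξ]` of `ξ` in the unitary dual. -/
def UnitaryIrrep.toDual (ξ : UnitaryIrrep.{w} G) : UnitaryDual.{w} G := Quotient.mk _ ξ

/-- The Fourier coefficient `f̂(ξ) = ∫ f(x) ξ(x)^* dx` of a function. -/
noncomputable def fourierCoefficient [MeasurableSpace G] (μ : Measure G) (f : G → ℂ)
    (ξ : UnitaryIrrep.{w} G) : ξ.space →L[ℂ] ξ.space :=
  ∫ x, f x • ContinuousLinearMap.adjoint (ξ.op x) ∂μ

end UnitaryDual

/-! ### Convolution kernels and symbols on a compact Lie group -/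

section Symbols

variable {E H G : Type*} [NormedAddCommGroup E] [NormedSpace ℝ E] [FiniteDimensional ℝ E]
  [TopologicalSpace H] {I : ModelWithCorners ℝ E H} [TopologicalSpace G] [ChartedSpace H G]
  [Group G] [LieGroup I ∞ G]

/-- The diffeomorphism `y ↦ y⁻¹ x` of `G`, whose inverse is `z ↦ x z⁻¹`. -/
def invMulDiffeo (I : ModelWithCorners ℝ E H) [LieGroup I ∞ G] (x : G) : G ≃ₘ^∞⟮I, I⟯ G where
  toFun y := y⁻¹ * x
  invFun z := x * z⁻¹
  left_inv y := by simp
  right_inv z := by simp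
  contMDiff_toFun := (contMDiff_inv I ∞).mul contMDiff_const
  contMDiff_invFun := contMDiff_const.mul (contMDiff_inv I ∞)

/-- The distribution `K_A(x, ·)`, where `K_A` is the Schwartz kernel of `A`:
`A f (x) = ∫ K_A(x, y) f(y) dy` in the sense of distributions. -/
noncomputable def schwartzKernelAt (A : SmoothFunction I G →L[ℂ] SmoothFunction I G) (x : G) :
    SmoothDistribution I G :=
  (diracDistribution x).comp A

/-- The distribution `r_x = R_A(x, ·)`, where `R_A` is the right-convolution kernel of `A`:
`A f (x) = ∫ K_A(x, y) f(y) dy = ∫ f(y) R_A(x, y⁻¹ x) dy` in the sense of distributions, that is,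
`K_A(x, ·)` is the pullback of `R_A(x, ·)` by the measure-preserving map `y ↦ y⁻¹ x`. -/
noncomputable def rightKernelAt (A : SmoothFunction I G →L[ℂ] SmoothFunction I G) (x : G) :
    SmoothDistribution I G :=
  (schwartzKernelAt A x).comp (SmoothFunction.compDiffeo (invMulDiffeo I x))

/-- `R_A(x, ·)` is the only distribution with `A f (x) = ∫ f(y) R_A(x, y⁻¹ x) dy`, i.e. with
`A f (x) = ∫ f(x z⁻¹) R_A(x, z) dz`, for all test functions `f`. -/
theorem eq_rightKernelAt_iff (A : SmoothFunction I G →L[ℂ] SmoothFunction I G) (x : G)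
    (r : SmoothDistribution I G) :
    r = rightKernelAt A x ↔
      ∀ f : SmoothFunction I G, A f x = r (SmoothFunction.compDiffeo (invMulDiffeo I x).symm f) := by
  have h1 : ∀ f : SmoothFunction I G, SmoothFunction.compDiffeo (invMulDiffeo I x)
      (SmoothFunction.compDiffeo (invMulDiffeo I x).symm f) = f := fun f => by ext y; simp
  have h2 : ∀ g : SmoothFunction I G, SmoothFunction.compDiffeo (invMulDiffeo I x).symm
      (SmoothFunction.compDiffeo (invMulDiffeo I x) g) = g := fun f => by ext y; simp
  constructor
  · rintro rfl f
    change A f x = A (SmoothFunction.compDiffeo _ (SmoothFunction.compDiffeo _ f)) x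
    rw [h1]
  · intro h
    ext g
    have := h (SmoothFunction.compDiffeo (invMulDiffeo I x) g)
    rw [h2] at this
    exact this.symm

variable [I.Boundaryless] [CompactSpace G] [T2Space G]

theorem UnitaryIrrep.contMDiff_op (ξ : UnitaryIrrep.{w} G) :
    ContMDiff I 𝓘(ℝ, ξ.space →L[ℂ] ξ.space) ∞ ξ.op :=
  contMDiff_of_continuous_monoidHom I ξ.op ξ.continuous_op

/-- The function `y ↦ (ξ(y)^* u, v)`, where the inner product `(·, ·)` is linear in the first
argument. -/
noncomputable def UnitaryIrrep.adjointCoefficient (I : ModelWithCorners ℝ E H) [I.Boundaryless]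
    [LieGroup I ∞ G] (ξ : UnitaryIrrep.{w} G) (u v : ξ.space) :
    SmoothFunction I G where
  val y := inner ℂ v (ContinuousLinearMap.adjoint (ξ.op y) u)
  property := by
    have h1 : ∀ y, inner ℂ v (ContinuousLinearMap.adjoint (ξ.op y) u) =
        Complex.conjCLE (inner ℂ u (ξ.op y v)) := fun y => by
      rw [ContinuousLinearMap.adjoint_inner_right, Complex.conjCLE_apply, inner_conj_symm]
    let T : (ξ.space →L[ℂ] ξ.space) →L[ℝ] ℂ :=
      (Complex.conjCLE : ℂ →L[ℝ] ℂ).comp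
        (((innerSL ℂ u).comp (ContinuousLinearMap.apply ℂ ξ.space v)).restrictScalars ℝ)
    have h2 := T.contMDiff (n := ∞).comp ξ.contMDiff_op (I := I)
    exact h2.congr h1

/-- The Fourier coefficient `T̂(ξ) = ∫ T(y) ξ(y)^* dy ∈ End(H_ξ)` of a distribution `T`, written in
an orthonormal basis of `H_ξ`; see `inner_distFourierCoefficient`. -/
noncomputable def distFourierCoefficient (T : SmoothDistribution I G) (ξ : UnitaryIrrep.{w} G) :
    ξ.space →L[ℂ] ξ.space :=
  LinearMap.toContinuousLinearMap
    { toFun := fun u => ∑ i, T (ξ.adjointCoefficient I u (stdOrthonormalBasis ℂ ξ.space i)) •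
        stdOrthonormalBasis ℂ ξ.space i
      map_add' := fun u u' => by
        rw [← Finset.sum_add_distrib]
        refine Finset.sum_congr rfl fun i _ => ?_
        rw [← add_smul, ← map_add]
        congr 2
        ext y
        change inner ℂ _ (ContinuousLinearMap.adjoint (ξ.op y) (u + u')) =
          inner ℂ _ (ContinuousLinearMap.adjoint (ξ.op y) u) +
            inner ℂ _ (ContinuousLinearMap.adjoint (ξ.op y) u')
        rw [map_add, inner_add_right]
      map_smul' := fun c u => by
        rw [RingHom.id_apply, Finset.smul_sum]
        refine Finset.sum_congr rfl fun i _ => ?_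
        rw [← smul_assoc, ← ContinuousLinearMap.map_smul T]
        congr 2
        ext y
        change inner ℂ _ (ContinuousLinearMap.adjoint (ξ.op y) (c • u)) =
          c * inner ℂ _ (ContinuousLinearMap.adjoint (ξ.op y) u)
        rw [ContinuousLinearMap.map_smul, inner_smul_right] }

/-- `T̂(ξ)` is the operator with `(T̂(ξ) u, v) = ∫ T(y) (ξ(y)^* u, v) dy` for all `u, v`. -/
theorem inner_distFourierCoefficient (T : SmoothDistribution I G) (ξ : UnitaryIrrep.{w} G)
    (u v : ξ.space) :
    inner ℂ v (distFourierCoefficient T ξ u) = T (ξ.adjointCoefficient I u v) := by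
  set b := stdOrthonormalBasis ℂ ξ.space
  have h : ξ.adjointCoefficient I u v =
      ∑ i, (inner ℂ v (b i) : ℂ) • ξ.adjointCoefficient I u (b i) := by
    ext y
    have : ∀ s : Finset (Fin (Module.finrank ℂ ξ.space)),
        (∑ i ∈ s, (inner ℂ v (b i) : ℂ) • ξ.adjointCoefficient I u (b i)) y =
          ∑ i ∈ s, (inner ℂ v (b i) : ℂ) * (ξ.adjointCoefficient I u (b i)) y := fun s => by
      induction s using Finset.induction_on with
      | empty => rfl
      | insert a s ha ih => rw [Finset.sum_insert ha, Finset.sum_insert ha, ← ih]; rfl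
    rw [this]
    exact (b.sum_inner_mul_inner v _).symm
  rw [h, map_sum]
  change inner ℂ v (∑ i, T (ξ.adjointCoefficient I u (b i)) • b i) = _
  rw [inner_sum]
  refine Finset.sum_congr rfl fun i _ => ?_
  rw [inner_smul_right, map_smul, smul_eq_mul, mul_comm]

/-- The symbol `σ_A(x, ξ) = r̂_x(ξ)` of `A`, where `r_x = R_A(x, ·)`. -/
noncomputable def operatorSymbol (A : SmoothFunction I G →L[ℂ] SmoothFunction I G) (x : G)
    (ξ : UnitaryIrrep.{w} G) : ξ.space →L[ℂ] ξ.space :=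
  distFourierCoefficient (rightKernelAt A x) ξ

end Symbols

/-! ### Schur orthogonality -/

section Schur

variable {G : Type*} [Group G] [TopologicalSpace G]

theorem UnitaryIrrep.inner_op (ξ : UnitaryIrrep.{w} G) (x : G) (u v : ξ.space) :
    inner ℂ (ξ.op x u) (ξ.op x v) = inner ℂ u v :=
  ξ.inner_rep x u v

theorem UnitaryIrrep.op_inv_op (ξ : UnitaryIrrep.{w} G) (x : G) (u : ξ.space) :
    ξ.op x⁻¹ (ξ.op x u) = u := by
  rw [← mul_apply_eq_comp, ← map_mul]; simp

theorem UnitaryIrrep.op_op_inv (ξ : UnitaryIrrep.{w} G) (x : G) (u : ξ.space) :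
    ξ.op x (ξ.op x⁻¹ u) = u := by
  rw [← mul_apply_eq_comp, ← map_mul]; simp

theorem UnitaryIrrep.adjoint_op (ξ : UnitaryIrrep.{w} G) (x : G) :
    ContinuousLinearMap.adjoint (ξ.op x) = ξ.op x⁻¹ := by
  symm
  rw [ContinuousLinearMap.eq_adjoint_iff]
  intro u v
  rw [← ξ.inner_op x, ξ.op_op_inv]

theorem UnitaryIrrep.nontrivial_space (ξ : UnitaryIrrep.{w} G) : Nontrivial ξ.space := by
  have := ξ.irreducible
  by_contra h
  rw [not_nontrivial_iff_subsingleton] at h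
  refine (bot_ne_top : (⊥ : Subrepresentation ξ.rep) ≠ ⊤) ?_
  apply Subrepresentation.toSubmodule_injective
  exact Subsingleton.elim _ _

/-- Schur's lemma: an operator commuting with an irreducible representation is a scalar. -/
theorem UnitaryIrrep.exists_eq_smul_one (ξ : UnitaryIrrep.{w} G) (S : ξ.space →L[ℂ] ξ.space)
    (hS : ∀ x u, S (ξ.op x u) = ξ.op x (S u)) :
    ∃ c : ℂ, S = c • (1 : ξ.space →L[ℂ] ξ.space) := by
  have := ξ.irreducible
  obtain ⟨c, hc⟩ := (Representation.IsIrreducible.algebraMap_intertwiningMap_bijective_of_isAlgClosed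
    (k := ℂ) (ρ := ξ.rep)).2 ⟨S.toLinearMap, fun x => LinearMap.ext fun u => hS x u⟩
  refine ⟨c, ?_⟩
  ext u
  exact (congrArg (fun T => T.toLinearMap u) hc).symm

/-- A non-zero intertwining operator between irreducible unitary representations makes them
unitarily equivalent. -/
theorem UnitaryIrrep.equiv_of_intertwining (ξ η : UnitaryIrrep.{w} G) (S : ξ.space →L[ℂ] η.space)
    (hS : ∀ x u, S (ξ.op x u) = η.op x (S u)) (h0 : S ≠ 0) : ξ ≈ η := by
  have hS' : ∀ x u, ContinuousLinearMap.adjoint S (η.op x u) =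
      ξ.op x (ContinuousLinearMap.adjoint S u) := fun x u => by
    refine ext_inner_left ℂ fun v => ?_
    rw [ContinuousLinearMap.adjoint_inner_right, ← ξ.inner_op x⁻¹, ξ.op_inv_op,
      ContinuousLinearMap.adjoint_inner_right, hS, ← η.inner_op x⁻¹, η.op_inv_op]
  obtain ⟨c, hc⟩ := ξ.exists_eq_smul_one (ContinuousLinearMap.adjoint S ∘L S)
    fun x u => by simp [hS, hS']
  obtain ⟨c', hc'⟩ := η.exists_eq_smul_one (S ∘L ContinuousLinearMap.adjoint S)
    fun x u => by simp [hS, hS']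
  have hin : ∀ u v, inner ℂ (S u) (S v) = c * inner ℂ u v := fun u v => by
    rw [← ContinuousLinearMap.adjoint_inner_right, ← ContinuousLinearMap.comp_apply, hc]
    simp [inner_smul_right]
  obtain ⟨u₀, hu₀⟩ : ∃ u, S u ≠ 0 := by
    by_contra! h
    exact h0 (ContinuousLinearMap.ext h)
  have hu₀' : u₀ ≠ 0 := fun h => hu₀ (by rw [h, map_zero])
  set r : ℝ := ‖S u₀‖ ^ 2 / ‖u₀‖ ^ 2
  have hr : 0 < r := div_pos (by positivity) (by positivity)
  have hcr : c = r := by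
    have := hin u₀ u₀
    rw [inner_self_eq_norm_sq_to_K, inner_self_eq_norm_sq_to_K] at this
    have h1 : ((‖u₀‖ : ℂ)) ^ 2 ≠ 0 := by simpa using hu₀'
    simp only [r]
    push_cast
    rw [eq_div_iff h1]
    exact this.symm
  have hnorm : ∀ u, ‖S u‖ = √r * ‖u‖ := fun u => by
    have := hin u u
    rw [inner_self_eq_norm_sq_to_K, inner_self_eq_norm_sq_to_K, hcr] at this
    have h2 : ‖S u‖ ^ 2 = r * ‖u‖ ^ 2 := by
      apply Complex.ofReal_injective
      push_cast
      exact this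
    rw [← Real.sqrt_sq (norm_nonneg (S u)), h2, Real.sqrt_mul hr.le, Real.sqrt_sq (norm_nonneg u)]
  have hc'0 : c' ≠ 0 := by
    rintro rfl
    have h3 : S (ContinuousLinearMap.adjoint S (S u₀)) = 0 := by
      rw [← ContinuousLinearMap.comp_apply, hc']; simp
    rw [← ContinuousLinearMap.comp_apply (ContinuousLinearMap.adjoint S), hc] at h3
    simp only [smul_apply, map_smul, smul_eq_zero] at h3
    rcases h3 with h3 | h3
    · rw [hcr] at h3
      exact hr.ne' (by exact_mod_cast h3)
    · exact hu₀ h3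
  have hsq : √r ≠ 0 := (Real.sqrt_pos.2 hr).ne'
  let U : ξ.space →ₗᵢ[ℂ] η.space :=
    ⟨((√r : ℂ)⁻¹ • S).toLinearMap, fun u => by
      change ‖(√r : ℂ)⁻¹ • S u‖ = ‖u‖
      rw [norm_smul, hnorm, norm_inv, Complex.norm_real, Real.norm_of_nonneg (Real.sqrt_nonneg r),
        inv_mul_cancel_left₀ hsq]⟩
  have hU : Function.Surjective U := fun v => by
    refine ⟨(√r : ℂ) • c'⁻¹ • ContinuousLinearMap.adjoint S v, ?_⟩
    change (√r : ℂ)⁻¹ • S _ = v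
    have h4 : S (ContinuousLinearMap.adjoint S v) = c' • v := by
      rw [← ContinuousLinearMap.comp_apply, hc']; simp
    rw [map_smul, map_smul, h4, inv_smul_smul₀ hc'0, inv_smul_smul₀ (by exact_mod_cast hsq)]
  refine ⟨LinearIsometryEquiv.ofSurjective U hU, fun x v => ?_⟩
  change (√r : ℂ)⁻¹ • S (ξ.op x v) = η.op x ((√r : ℂ)⁻¹ • S v)
  rw [hS, map_smul]

/-- The matrix coefficient `x ↦ ⟨v, ξ(x) u⟩`. -/
noncomputable def UnitaryIrrep.coefficient (ξ : UnitaryIrrep.{w} G) (u v : ξ.space) : C(G, ℂ) where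
  toFun x := inner ℂ v (ξ.op x u)
  continuous_toFun := by
    have := ξ.continuous_op
    fun_prop

@[simp] theorem UnitaryIrrep.coefficient_apply (ξ : UnitaryIrrep.{w} G) (u v : ξ.space) (x : G) :
    ξ.coefficient u v x = inner ℂ v (ξ.op x u) := rfl

theorem UnitaryIrrep.continuous_op_comp_op_inv [IsTopologicalGroup G]
    (ξ η : UnitaryIrrep.{w} G)
    (T : ξ.space →L[ℂ] η.space) : Continuous fun x => η.op x ∘L T ∘L ξ.op x⁻¹ := by
  have h1 := ξ.continuous_op
  have h2 := η.continuous_op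
  exact h2.clm_comp (continuous_const.clm_comp (h1.comp continuous_inv))

variable [CompactSpace G] [MeasurableSpace G] [BorelSpace G] [IsTopologicalGroup G]
  (μ : Measure G) [IsProbabilityMeasure μ]

theorem integrable_of_continuous_of_compactSpace {X W : Type*} [TopologicalSpace X]
    [CompactSpace X] [MeasurableSpace X] [BorelSpace X] (μ : Measure X) [IsFiniteMeasure μ]
    [NormedAddCommGroup W] {f : X → W} (hf : Continuous f) : Integrable f μ :=
  hf.integrable_of_hasCompactSupport (HasCompactSupport.of_compactSpace _)

/-- The average `∫ η(x) T ξ(x)^* dx`. -/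
noncomputable def UnitaryIrrep.averageOp (ξ η : UnitaryIrrep.{w} G) (T : ξ.space →L[ℂ] η.space) :
    ξ.space →L[ℂ] η.space :=
  ∫ x, η.op x ∘L T ∘L ξ.op x⁻¹ ∂μ

theorem UnitaryIrrep.averageOp_apply (ξ η : UnitaryIrrep.{w} G) (T : ξ.space →L[ℂ] η.space)
    (u : ξ.space) : averageOp μ ξ η T u = ∫ x, η.op x (T (ξ.op x⁻¹ u)) ∂μ :=
  ContinuousLinearMap.integral_apply (integrable_of_continuous_of_compactSpace μ
    (continuous_op_comp_op_inv ξ η T)) u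

theorem UnitaryIrrep.averageOp_intertwining [μ.IsMulLeftInvariant] (ξ η : UnitaryIrrep.{w} G)
    (T : ξ.space →L[ℂ] η.space) (y : G) (u : ξ.space) :
    averageOp μ ξ η T (ξ.op y u) = η.op y (averageOp μ ξ η T u) := by
  rw [averageOp_apply, averageOp_apply, ← integral_mul_left_eq_self _ y,
    ← ContinuousLinearMap.integral_comp_comm]
  · refine integral_congr_ae (.of_forall fun x => ?_)
    simp only [mul_inv_rev, map_mul, mul_apply_eq_comp, ξ.op_inv_op]
  · exact integrable_of_continuous_of_compactSpace μ
      ((continuous_op_comp_op_inv ξ η T).clm_apply continuous_const)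

theorem UnitaryIrrep.inner_averageOp_rankOne (ξ η : UnitaryIrrep.{w} G) (u' v' : ξ.space)
    (u v : η.space) :
    inner ℂ v (averageOp μ ξ η ((innerSL ℂ u').smulRight u) v') =
      ∫ x, η.coefficient u v x * (starRingEnd ℂ) (ξ.coefficient u' v' x) ∂μ := by
  rw [averageOp_apply, ← integral_inner]
  · refine integral_congr_ae (.of_forall fun x => ?_)
    simp only [ContinuousLinearMap.smulRight_apply, innerSL_apply_apply, map_smul, inner_smul_right,
      coefficient_apply, inner_conj_symm]
    rw [mul_comm, ← ξ.inner_op x u', ξ.op_op_inv]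
  · exact integrable_of_continuous_of_compactSpace μ
      ((continuous_op_comp_op_inv ξ η ((innerSL ℂ u').smulRight u)).clm_apply
        (continuous_const (y := v')))

/-- Schur orthogonality for inequivalent representations. -/
theorem UnitaryIrrep.integral_coefficient_mul_conj_of_not_equiv [μ.IsMulLeftInvariant]
    (ξ η : UnitaryIrrep.{w} G)
    (h : ¬ ξ ≈ η) (u' v' : ξ.space) (u v : η.space) :
    ∫ x, η.coefficient u v x * (starRingEnd ℂ) (ξ.coefficient u' v' x) ∂μ = 0 := by
  rw [← inner_averageOp_rankOne]
  have : averageOp μ ξ η ((innerSL ℂ u').smulRight u) = 0 := by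
    by_contra h0
    exact h (equiv_of_intertwining ξ η _ (averageOp_intertwining μ ξ η _) h0)
  simp [this]

theorem UnitaryIrrep.trace_averageOp (ξ : UnitaryIrrep.{w} G) (T : ξ.space →L[ℂ] ξ.space) :
    LinearMap.trace ℂ ξ.space (averageOp μ ξ ξ T).toLinearMap =
      LinearMap.trace ℂ ξ.space T.toLinearMap := by
  let tr : (ξ.space →L[ℂ] ξ.space) →L[ℂ] ℂ := LinearMap.toContinuousLinearMap
    (LinearMap.trace ℂ ξ.space ∘ₗ ContinuousLinearMap.coeLM ℂ)
  change tr (averageOp μ ξ ξ T) = tr T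
  rw [averageOp, ← ContinuousLinearMap.integral_comp_comm]
  · have : ∀ x, tr (ξ.op x ∘L T ∘L ξ.op x⁻¹) = tr T := fun x => by
      change LinearMap.trace ℂ ξ.space ((ξ.op x).toLinearMap * (T ∘L ξ.op x⁻¹).toLinearMap) = _
      rw [LinearMap.trace_mul_comm]
      change tr (T ∘L ξ.op x⁻¹ ∘L ξ.op x) = _
      congr 1
      ext u
      simp [ξ.op_inv_op]
    simp [this]
  · exact integrable_of_continuous_of_compactSpace μ (continuous_op_comp_op_inv ξ ξ T)

/-- Schur orthogonality for one representation. -/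
theorem UnitaryIrrep.dim_mul_integral_coefficient_mul_conj [μ.IsMulLeftInvariant]
    (ξ : UnitaryIrrep.{w} G)
    (u' v' u v : ξ.space) :
    ξ.dim * ∫ x, ξ.coefficient u v x * (starRingEnd ℂ) (ξ.coefficient u' v' x) ∂μ =
      inner ℂ u' u * inner ℂ v v' := by
  rw [← inner_averageOp_rankOne]
  obtain ⟨c, hc⟩ := ξ.exists_eq_smul_one _
    (averageOp_intertwining μ ξ ξ ((innerSL ℂ u').smulRight u))
  have h1 := trace_averageOp μ ξ ((innerSL ℂ u').smulRight u)
  have h2 : LinearMap.trace ℂ ξ.space ((innerSL ℂ u').smulRight u).toLinearMap = inner ℂ u' u := by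
    exact LinearMap.trace_smulRight (innerSL ℂ u').toLinearMap u
  have h3 : LinearMap.trace ℂ ξ.space (c • (1 : ξ.space →L[ℂ] ξ.space)).toLinearMap = c * ξ.dim := by
    change LinearMap.trace ℂ ξ.space (c • (1 : ξ.space →ₗ[ℂ] ξ.space)) = _
    rw [map_smul, LinearMap.trace_one]; rfl
  rw [hc] at h1 ⊢
  rw [← h2, ← h1, h3]
  simp
  ring

end Schur

/-! ### Compact convolution operators on `L²` of a compact group -/

section IntegralOperator

variable {X F : Type*} [TopologicalSpace X] [CompactSpace X] [NormedAddCommGroup F]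
  [InnerProductSpace ℂ F]

/-- The operator `h ↦ (x ↦ ⟨κ x, h⟩)` defined by a continuous family of vectors. -/
noncomputable def integralOperator (κ : C(X, F)) : F →L[ℂ] C(X, ℂ) :=
  LinearMap.mkContinuous
    { toFun := fun h => ⟨fun x => inner ℂ (κ x) h, by fun_prop⟩
      map_add' := fun h h' => by ext x; simp
      map_smul' := fun c h => by ext x; simp } ‖κ‖ fun h => by
    refine (ContinuousMap.norm_le _ (by positivity)).2 fun x => ?_
    exact (norm_inner_le_norm _ _).trans (by gcongr; exact κ.norm_coe_le_norm x)

@[simp] theorem integralOperator_apply (κ : C(X, F)) (h : F) (x : X) :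
    integralOperator κ h x = inner ℂ (κ x) h := rfl

theorem isCompactOperator_integralOperator (κ : C(X, F)) :
    IsCompactOperator (integralOperator κ) := by
  rw [← ContinuousLinearMap.coe_coe,
    isCompactOperator_iff_isCompact_closure_image_closedBall _ one_pos]
  let e := ContinuousMap.linearIsometryBoundedOfCompact X ℂ ℂ
  have h1 : IsCompact (closure (e '' (integralOperator κ '' Metric.closedBall 0 1))) := by
    refine BoundedContinuousFunction.arzela_ascoli (Metric.closedBall (0 : ℂ) ‖κ‖)
      (isCompact_closedBall _ _) _ ?_ ?_
    · rintro _ x ⟨_, ⟨h, hh, rfl⟩, rfl⟩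
      rw [mem_closedBall_zero_iff] at hh ⊢
      calc ‖inner ℂ (κ x) h‖ ≤ ‖κ x‖ * ‖h‖ := norm_inner_le_norm _ _
        _ ≤ ‖κ‖ * 1 := by gcongr; exact κ.norm_coe_le_norm x
        _ = ‖κ‖ := mul_one _
    · intro x
      rw [Metric.equicontinuousAt_iff_right]
      intro ε hε
      have h2 : ∀ᶠ y in 𝓝 x, dist (κ y) (κ x) < ε :=
        (κ.continuous.tendsto x).eventually (Metric.ball_mem_nhds _ hε)
      filter_upwards [h2] with y hy
      rintro ⟨_, _, ⟨h, hh, rfl⟩, rfl⟩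
      rw [mem_closedBall_zero_iff] at hh
      change dist (inner ℂ (κ x) h) (inner ℂ (κ y) h) < ε
      rw [dist_eq_norm, ← inner_sub_left]
      calc ‖inner ℂ (κ x - κ y) h‖ ≤ ‖κ x - κ y‖ * ‖h‖ := norm_inner_le_norm _ _
        _ ≤ ‖κ x - κ y‖ * 1 := by gcongr
        _ = dist (κ y) (κ x) := by rw [mul_one, dist_comm, dist_eq_norm]
        _ < ε := hy
  have h3 := h1.image e.symm.continuous
  have h4 := e.symm.toHomeomorph.image_closure (e '' (integralOperator κ '' Metric.closedBall 0 1))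
  change e.symm '' _ = closure (e.symm '' _) at h4
  rwa [h4, ← image_comp, e.symm_comp_self, image_id] at h3

end IntegralOperator

section Convolution

variable {G : Type*} [Group G] [TopologicalSpace G] [IsTopologicalGroup G] [CompactSpace G]
  [MeasurableSpace G] [BorelSpace G] (μ : Measure G) [IsProbabilityMeasure μ]

/-- The family `x ↦ (y ↦ conj k(x y⁻¹))` representing the convolution operator with kernel `k`. -/
noncomputable def convolutionKernel (k : C(G, ℂ)) : C(G, Lp ℂ 2 μ) :=
  (⟨ContinuousMap.toLp 2 μ ℂ, (ContinuousMap.toLp 2 μ ℂ).continuous⟩ : C(C(G, ℂ), Lp ℂ 2 μ)).comp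
    (ContinuousMap.curry ⟨fun p : G × G => (starRingEnd ℂ) (k (p.1 * p.2⁻¹)), by fun_prop⟩)

/-- The convolution operator `h ↦ k * h` on `L²`. -/
noncomputable def convolutionOperator (k : C(G, ℂ)) : Lp ℂ 2 μ →L[ℂ] Lp ℂ 2 μ :=
  ContinuousMap.toLp 2 μ ℂ ∘L integralOperator (convolutionKernel μ k)

theorem isCompactOperator_convolutionOperator (k : C(G, ℂ)) :
    IsCompactOperator (convolutionOperator μ k) :=
  (isCompactOperator_integralOperator (convolutionKernel μ k)).clm_comp (ContinuousMap.toLp 2 μ ℂ)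

theorem integralOperator_convolutionKernel_toLp (k g : C(G, ℂ)) (x : G) :
    integralOperator (convolutionKernel μ k) (ContinuousMap.toLp 2 μ ℂ g) x =
      ∫ y, k (x * y⁻¹) * g y ∂μ := by
  rw [integralOperator_apply]
  refine (ContinuousMap.inner_toLp μ _ _).trans ?_
  refine integral_congr_ae (.of_forall fun y => ?_)
  simp [mul_comm]

theorem isSymmetric_convolutionOperator [SecondCountableTopology G] [T2Space G] (k : C(G, ℂ))
    (hk : ∀ t, (starRingEnd ℂ) (k t⁻¹) = k t) :
    (convolutionOperator μ k : Lp ℂ 2 μ →ₗ[ℂ] Lp ℂ 2 μ).IsSymmetric := by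
  have key : ∀ f g : C(G, ℂ), inner ℂ (convolutionOperator μ k (ContinuousMap.toLp 2 μ ℂ f))
      (ContinuousMap.toLp 2 μ ℂ g) = inner ℂ (ContinuousMap.toLp 2 μ ℂ f)
      (convolutionOperator μ k (ContinuousMap.toLp 2 μ ℂ g)) := by
    intro f g
    have h1 := ContinuousMap.inner_toLp μ (integralOperator (convolutionKernel μ k)
      (ContinuousMap.toLp 2 μ ℂ f)) g
    have h2 := ContinuousMap.inner_toLp μ f (integralOperator (convolutionKernel μ k)
      (ContinuousMap.toLp 2 μ ℂ g))
    refine h1.trans (Eq.trans ?_ h2.symm)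
    simp_rw [integralOperator_convolutionKernel_toLp, ← integral_conj,
      ← integral_const_mul, ← integral_mul_const]
    rw [integral_integral_swap]
    · refine integral_congr_ae (.of_forall fun y => integral_congr_ae (.of_forall fun x => ?_))
      have := hk (y * x⁻¹)
      rw [mul_inv_rev, inv_inv] at this
      simp only [map_mul]
      rw [this]
      ring
    · exact integrable_of_continuous_of_compactSpace _ (by fun_prop)
  have hd : DenseRange (ContinuousMap.toLp (E := ℂ) 2 μ ℂ) :=
    ContinuousMap.toLp_denseRange ℂ μ ℂ (by simp)
  intro f g
  refine hd.induction_on₂ (p := fun f g => inner ℂ (convolutionOperator μ k f) g =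
    inner ℂ f (convolutionOperator μ k g)) ?_ key f g
  exact isClosed_eq (by fun_prop) (by fun_prop)

variable [μ.IsMulRightInvariant]

/-- Right translation `(R_z h)(x) = h(xz)` on `L²`. -/
noncomputable def rightTranslation (z : G) : Lp ℂ 2 μ →ₗᵢ[ℂ] Lp ℂ 2 μ :=
  Lp.compMeasurePreservingₗᵢ ℂ (· * z) (measurePreserving_mul_right μ z)

theorem rightTranslation_toLp (z : G) (f : C(G, ℂ)) :
    rightTranslation μ z (ContinuousMap.toLp 2 μ ℂ f) =
      ContinuousMap.toLp 2 μ ℂ (f.comp ⟨(· * z), by fun_prop⟩) := by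
  apply Lp.ext
  have h1 := Lp.coeFn_compMeasurePreserving (ContinuousMap.toLp 2 μ ℂ f)
    (measurePreserving_mul_right μ z)
  have h2 := ContinuousMap.coeFn_toLp (p := 2) (𝕜 := ℂ) μ (f.comp ⟨(· * z), by fun_prop⟩)
  have h3 := (measurePreserving_mul_right μ z).quasiMeasurePreserving.ae_eq_comp
    (ContinuousMap.coeFn_toLp (p := 2) (𝕜 := ℂ) μ f)
  exact h1.trans (h3.trans h2.symm)

variable [T2Space G] [SecondCountableTopology G]

omit [μ.IsMulRightInvariant] in
theorem toLp_induction {p : Lp ℂ 2 μ → Prop} (hp : IsClosed {h | p h})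
    (h : ∀ f : C(G, ℂ), p (ContinuousMap.toLp 2 μ ℂ f)) (g : Lp ℂ 2 μ) : p g :=
  (ContinuousMap.toLp_denseRange ℂ μ ℂ (by simp)).induction_on g hp h

/-- Right translations as a representation on `L²`. -/
noncomputable def rightRegular : G →* (Lp ℂ 2 μ →L[ℂ] Lp ℂ 2 μ) where
  toFun z := (rightTranslation μ z).toContinuousLinearMap
  map_one' := by
    ext1 h
    refine toLp_induction μ (isClosed_eq (by fun_prop) (by fun_prop)) (fun f => ?_) h
    refine (rightTranslation_toLp μ 1 f).trans ?_
    exact congrArg (ContinuousMap.toLp 2 μ ℂ) (ContinuousMap.ext fun x => by simp)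
  map_mul' z z' := by
    ext1 h
    refine toLp_induction μ (isClosed_eq (by fun_prop) (by fun_prop)) (fun f => ?_) h
    refine (rightTranslation_toLp μ _ f).trans ?_
    change _ = rightTranslation μ z (rightTranslation μ z' _)
    rw [rightTranslation_toLp, rightTranslation_toLp]
    congr 1
    ext x
    simp [mul_assoc]

theorem rightRegular_toLp (z : G) (f : C(G, ℂ)) :
    rightRegular μ z (ContinuousMap.toLp 2 μ ℂ f) =
      ContinuousMap.toLp 2 μ ℂ (f.comp ⟨(· * z), by fun_prop⟩) :=
  rightTranslation_toLp μ z f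

theorem inner_rightRegular (z : G) (f g : Lp ℂ 2 μ) :
    inner ℂ (rightRegular μ z f) (rightRegular μ z g) = inner ℂ f g :=
  (rightTranslation μ z).inner_map_map f g

theorem continuous_rightRegular (h : Lp ℂ 2 μ) : Continuous fun z => rightRegular μ z h := by
  let m : C(G × G, G) := ⟨fun p => p.2 * p.1, by fun_prop⟩
  exact (continuous_const (y := h)).compMeasurePreservingLp m.curry.continuous
    (fun z => measurePreserving_mul_right μ z) (by simp)

theorem integralOperator_convolutionKernel_rightRegular (k : C(G, ℂ)) (z x : G) (h : Lp ℂ 2 μ) :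
    integralOperator (convolutionKernel μ k) (rightRegular μ z h) x =
      integralOperator (convolutionKernel μ k) h (x * z) := by
  rw [integralOperator_apply, integralOperator_apply, ← inner_rightRegular μ z _ h]
  congr 1
  refine Eq.trans ?_ (rightRegular_toLp μ z _).symm
  refine congrArg (ContinuousMap.toLp 2 μ ℂ) (ContinuousMap.ext fun y => ?_)
  simp

theorem convolutionOperator_rightRegular (k : C(G, ℂ)) (z : G) (h : Lp ℂ 2 μ) :
    convolutionOperator μ k (rightRegular μ z h) =
      rightRegular μ z (convolutionOperator μ k h) := by
  refine Eq.trans ?_ (rightRegular_toLp μ z _).symm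
  change ContinuousMap.toLp 2 μ ℂ _ = _
  congr 1
  ext x
  exact integralOperator_convolutionKernel_rightRegular μ k z x h

end Convolution

/-! ### The Peter–Weyl theorem -/

section InvariantSubspaces

variable {G F : Type*} [NormedAddCommGroup F] [InnerProductSpace ℂ F]

/-- An irreducible finite-dimensional invariant subspace of a unitary representation is isomorphic
to a member of `UnitaryIrrep`. -/
theorem exists_unitaryIrrep_of_isMinimal [Group G] [TopologicalSpace G]
    (R : G →* (F →L[ℂ] F))
    (hR : ∀ z u v, inner ℂ (R z u) (R z v) = inner ℂ u v)
    (hcont : ∀ v, Continuous fun z => R z v) (W : Submodule ℂ F) [FiniteDimensional ℂ W]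
    (hW : ∀ z, ∀ w ∈ W, R z w ∈ W) (hne : W ≠ ⊥)
    (hmin : ∀ W' ≤ W, (∀ z, ∀ w ∈ W', R z w ∈ W') → W' = ⊥ ∨ W' = W) :
    ∃ (ξ : UnitaryIrrep.{w} G) (U : W ≃ₗᵢ[ℂ] ξ.space), ∀ (z : G) (v : W),
      U ⟨R z v, hW z v v.2⟩ = ξ.op z (U v) := by
  let ι := ULift.{w} (Fin (Module.finrank ℂ W))
  let U : W ≃ₗᵢ[ℂ] EuclideanSpace ℂ ι :=
    ((stdOrthonormalBasis ℂ W).reindex Equiv.ulift.symm).repr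
  let r : G →* Module.End ℂ W :=
    { toFun := fun z => (R z).toLinearMap.restrict (hW z)
      map_one' := by ext v; simp
      map_mul' := fun z z' => by ext v; simp }
  let ρ : Representation ℂ G (EuclideanSpace ℂ ι) :=
    { toFun := fun z => U.toLinearEquiv.conj (r z)
      map_one' := by
        ext v : 1
        simp [LinearEquiv.conj_apply]
      map_mul' := fun z z' => by
        ext v : 1
        simp [LinearEquiv.conj_apply] }
  have hρ : ∀ z v, ρ z v = U (r z (U.symm v)) := fun z v => rfl
  have hrU : ∀ z v, ρ z (U v) = U (r z v) := fun z v => by rw [hρ, U.symm_apply_apply]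
  have hirr : ρ.IsIrreducible :=
    { exists_pair_ne := by
        refine ⟨⊥, ⊤, fun h => hne ?_⟩
        rw [Submodule.eq_bot_iff]
        intro v hv
        have h1 : U ⟨v, hv⟩ ∈ (⊥ : Subrepresentation ρ) := h ▸ Submodule.mem_top
        have h2 : U ⟨v, hv⟩ = 0 := h1
        simpa using h2
      eq_bot_or_eq_top := fun S => by
        have hm : ∀ v : W, (v : F) ∈ (S.toSubmodule.comap U.toLinearEquiv.toLinearMap).map W.subtype ↔
            U v ∈ S.toSubmodule := fun v => by
          simp
        have hinv : ∀ z, ∀ w ∈ (S.toSubmodule.comap U.toLinearEquiv.toLinearMap).map W.subtype,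
            R z w ∈ (S.toSubmodule.comap U.toLinearEquiv.toLinearMap).map W.subtype := by
          rintro z _ ⟨v, hv, rfl⟩
          refine (hm (r z v)).2 ?_
          rw [← hrU]
          exact S.apply_mem_toSubmodule z hv
        rcases hmin _ (Submodule.map_subtype_le _ _) hinv with h | h
        · left
          apply Subrepresentation.toSubmodule_injective
          refine (Submodule.eq_bot_iff _).2 fun v hv => ?_
          have h3 := (hm (U.symm v)).2 (by rwa [U.apply_symm_apply])
          rw [h, Submodule.mem_bot] at h3
          simpa using h3
        · right
          apply Subrepresentation.toSubmodule_injective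
          refine (Submodule.eq_top_iff'.2 fun v => ?_)
          have h3 := (hm (U.symm v)).1 (by rw [h]; exact (U.symm v).2)
          rwa [U.apply_symm_apply] at h3 }
  refine ⟨⟨EuclideanSpace ℂ ι, ρ, fun v => ?_, fun z u v => ?_, hirr⟩, U, fun z v => ?_⟩
  · exact U.continuous.comp (Continuous.subtype_mk (hcont (U.symm v)) _)
  · rw [hρ, hρ, U.inner_map_map]
    exact (hR z _ _).trans (U.symm.inner_map_map u v)
  · exact (hrU z v).symm

/-- A non-zero finite-dimensional invariant subspace contains a minimal one. -/
theorem exists_minimal_invariant (R : G → F → F) (W : Submodule ℂ F) [FiniteDimensional ℂ W]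
    (hW : ∀ z, ∀ w ∈ W, R z w ∈ W) (hne : W ≠ ⊥) :
    ∃ N ≤ W, N ≠ ⊥ ∧ (∀ z, ∀ w ∈ N, R z w ∈ N) ∧
      ∀ W' ≤ N, (∀ z, ∀ w ∈ W', R z w ∈ W') → W' = ⊥ ∨ W' = N := by
  obtain ⟨N, ⟨hN1, hN2, hN3⟩, hmin⟩ := WellFounded.has_min
    (InvImage.wf (fun N : Submodule ℂ F => Module.finrank ℂ N) wellFounded_lt)
    {N | N ≤ W ∧ N ≠ ⊥ ∧ ∀ z, ∀ w ∈ N, R z w ∈ N} ⟨W, le_rfl, hne, hW⟩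
  refine ⟨N, hN1, hN2, hN3, fun W' hW' hinv => ?_⟩
  have : FiniteDimensional ℂ N := Submodule.finiteDimensional_of_le hN1
  by_contra! h
  exact hmin W' ⟨hW'.trans hN1, h.1, hinv⟩
    (Submodule.finrank_lt_finrank_of_lt (lt_of_le_of_ne hW' h.2))

end InvariantSubspaces

section PeterWeyl

variable {G : Type*} [Group G] [TopologicalSpace G] [CompactSpace G]
  [MeasurableSpace G] [BorelSpace G] (μ : Measure G) [IsProbabilityMeasure μ]
  (ρ : UnitaryDual.{w} G → UnitaryIrrep.{w} G)

/-- The span in `L²` of the matrix coefficients of the representations `ρ c`. -/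
noncomputable def coefficientSpan : Submodule ℂ (Lp ℂ 2 μ) :=
  Submodule.span ℂ {h | ∃ c u v, ContinuousMap.toLp 2 μ ℂ ((ρ c).coefficient u v) = h}

theorem coefficient_mem_coefficientSpan (hρ : ∀ c, (ρ c).toDual = c) (ξ : UnitaryIrrep.{w} G)
    (u v : ξ.space) : ContinuousMap.toLp 2 μ ℂ (ξ.coefficient u v) ∈ coefficientSpan μ ρ := by
  obtain ⟨U, hU⟩ : ξ ≈ ρ ξ.toDual := Quotient.exact (hρ ξ.toDual).symm
  refine Submodule.subset_span ⟨ξ.toDual, U u, U v, congrArg _ (ContinuousMap.ext fun x => ?_)⟩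
  refine Eq.trans ?_ (U.inner_map_map v (ξ.op x u))
  exact congrArg _ (hU x u).symm

variable [IsTopologicalGroup G] [μ.IsMulRightInvariant] [T2Space G] [SecondCountableTopology G]

theorem rightRegular_mem_coefficientSpan (z : G) {h : Lp ℂ 2 μ} (hh : h ∈ coefficientSpan μ ρ) :
    rightRegular μ z h ∈ coefficientSpan μ ρ := by
  induction hh using Submodule.span_induction with
  | mem h hh =>
    obtain ⟨c, u, v, rfl⟩ := hh
    rw [rightRegular_toLp]
    refine Submodule.subset_span ⟨c, (ρ c).op z u, v, congrArg _ (ContinuousMap.ext fun x => ?_)⟩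
    simp
  | zero => simp
  | add f g _ _ hf hg => rw [map_add]; exact add_mem hf hg
  | smul c f _ hf => rw [map_smul]; exact Submodule.smul_mem _ _ hf

theorem mem_coefficientSpan_of_eigenspace (hρ : ∀ c, (ρ c).toDual = c) (k : C(G, ℂ)) {l : ℂ}
    (hl : l ≠ 0) (W : Submodule ℂ (Lp ℂ 2 μ)) [FiniteDimensional ℂ W] (hne : W ≠ ⊥)
    (hW : ∀ z, ∀ h ∈ W, rightRegular μ z h ∈ W)
    (hmin : ∀ W' ≤ W, (∀ z, ∀ h ∈ W', rightRegular μ z h ∈ W') → W' = ⊥ ∨ W' = W)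
    (heig : ∀ h ∈ W, convolutionOperator μ k h = l • h) : W ≤ coefficientSpan μ ρ := by
  obtain ⟨ξ, U, hU⟩ := exists_unitaryIrrep_of_isMinimal.{w} (rightRegular μ) (inner_rightRegular μ)
    (continuous_rightRegular μ) W hW hne hmin
  intro h hh
  set κ := (starRingEnd ℂ) l⁻¹ • convolutionKernel μ k 1
  set v : W := W.orthogonalProjectionOnto κ
  have e : h = ContinuousMap.toLp 2 μ ℂ (ξ.coefficient (U ⟨h, hh⟩) (U v)) := by
    have h1 : h = l⁻¹ • convolutionOperator μ k h := by rw [heig h hh, inv_smul_smul₀ hl]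
    rw [convolutionOperator, ContinuousLinearMap.comp_apply, ← map_smul] at h1
    refine h1.trans (congrArg _ (ContinuousMap.ext fun x => ?_))
    rw [UnitaryIrrep.coefficient_apply, ← hU, U.inner_map_map]
    refine Eq.trans ?_ (Submodule.inner_orthogonalProjectionOnto_eq_of_mem_right
      ⟨rightRegular μ x h, hW x h hh⟩ κ).symm
    have h2 := integralOperator_convolutionKernel_rightRegular μ k x 1 h
    rw [one_mul, integralOperator_apply] at h2
    rw [inner_smul_left, h2]
    simp
  rw [e]
  exact coefficient_mem_coefficientSpan μ ρ hρ ξ _ _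

theorem eigenspace_le_coefficientSpan (hρ : ∀ c, (ρ c).toDual = c) (k : C(G, ℂ)) {l : ℂ}
    (hl : l ≠ 0) : Module.End.eigenspace (convolutionOperator μ k).toLinearMap l ≤
      coefficientSpan μ ρ := by
  set V := Module.End.eigenspace (convolutionOperator μ k).toLinearMap l
  have hfin : FiniteDimensional ℂ V :=
    ContinuousLinearMap.finite_dimensional_eigenspace (isCompactOperator_convolutionOperator μ k) l hl
  have hmem : ∀ h, h ∈ V ↔ convolutionOperator μ k h = l • h := fun h =>
    Module.End.mem_eigenspace_iff
  have hV : ∀ z, ∀ h ∈ V, rightRegular μ z h ∈ V := fun z h hh => by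
    rw [hmem] at hh ⊢
    rw [convolutionOperator_rightRegular, hh, map_smul]
  set K := V ⊓ coefficientSpan μ ρ
  have hKV : K ≤ V := inf_le_left
  have hKfin : FiniteDimensional ℂ K := Submodule.finiteDimensional_of_le hKV
  have hK : ∀ z, ∀ h ∈ K, rightRegular μ z h ∈ K := fun z h hh =>
    ⟨hV z h hh.1, rightRegular_mem_coefficientSpan μ ρ z hh.2⟩
  set W := Kᗮ ⊓ V
  have hWfin : FiniteDimensional ℂ W := Submodule.finiteDimensional_of_le inf_le_right
  have hW : ∀ z, ∀ h ∈ W, rightRegular μ z h ∈ W := fun z h hh => by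
    refine ⟨fun g hg => ?_, hV z h hh.2⟩
    rw [← inner_rightRegular μ z⁻¹, ← mul_apply_eq_comp (rightRegular μ z⁻¹)
      (rightRegular μ z), ← map_mul, inv_mul_cancel, map_one]
    exact hh.1 _ (hK _ _ hg)
  have hbot : W = ⊥ := by
    by_contra hne
    obtain ⟨N, hNW, hN0, hN, hmin⟩ := exists_minimal_invariant (fun z => rightRegular μ z) W hW hne
    have hNfin : FiniteDimensional ℂ N := Submodule.finiteDimensional_of_le hNW
    have h1 := mem_coefficientSpan_of_eigenspace μ ρ hρ k hl N hN0 hN hmin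
      fun h hh => (hmem h).1 (hNW hh).2
    refine hN0 ((Submodule.eq_bot_iff _).2 fun h hh => ?_)
    exact inner_self_eq_zero.1 ((hNW hh).1 h ⟨(hNW hh).2, h1 hh⟩)
  have := Submodule.sup_orthogonal_inf_of_hasOrthogonalProjection hKV
  rw [show Kᗮ ⊓ V = ⊥ from hbot, sup_bot_eq] at this
  rw [← this]
  exact inf_le_right

variable [μ.IsOpenPosMeasure]

theorem inner_toLp_eq_zero_of_hermitian (hρ : ∀ c, (ρ c).toDual = c) {h : Lp ℂ 2 μ}
    (hh : h ∈ (coefficientSpan μ ρ)ᗮ) (k : C(G, ℂ)) (hk : ∀ t, (starRingEnd ℂ) (k t⁻¹) = k t) :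
    inner ℂ (ContinuousMap.toLp 2 μ ℂ k) h = 0 := by
  have hsymm := isSymmetric_convolutionOperator μ k hk
  have h0 : convolutionOperator μ k h = 0 := by
    have hbot := ContinuousLinearMap.orthogonalComplement_iSup_eigenspaces_eq_bot
      (isCompactOperator_convolutionOperator μ k) hsymm
    rw [← Submodule.mem_bot ℂ, ← hbot, Submodule.mem_orthogonal]
    intro g hg
    induction hg using Submodule.iSup_induction' with
    | mem l g hg =>
      rw [Module.End.mem_eigenspace_iff] at hg
      have h1 : inner ℂ g (convolutionOperator μ k h) = inner ℂ (convolutionOperator μ k g) h :=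
        (hsymm g h).symm
      have h2 : convolutionOperator μ k g = l • g := hg
      rw [h1, h2]
      by_cases hl : l = 0
      · simp [hl]
      · rw [inner_smul_left, hh g (eigenspace_le_coefficientSpan μ ρ hρ k hl
          (Module.End.mem_eigenspace_iff.2 hg)), mul_zero]
    | zero => simp
    | add f g _ _ hf hg => rw [inner_add_left, hf, hg, add_zero]
  have h3 : integralOperator (convolutionKernel μ k) h = 0 :=
    ContinuousMap.toLp_injective μ (p := 2) (𝕜 := ℂ) (h0.trans (map_zero _).symm)
  have h4 := congrArg (fun f : C(G, ℂ) => f 1) h3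
  simp only [integralOperator_apply, ContinuousMap.zero_apply] at h4
  rw [← h4]
  congr 1
  refine congrArg (ContinuousMap.toLp 2 μ ℂ) (ContinuousMap.ext fun y => ?_)
  simp [hk]

/-- The Peter–Weyl theorem: matrix coefficients span a dense subspace of `L²`. -/
theorem topologicalClosure_coefficientSpan (hρ : ∀ c, (ρ c).toDual = c) :
    (coefficientSpan μ ρ).topologicalClosure = ⊤ := by
  rw [Submodule.topologicalClosure_eq_top_iff, Submodule.eq_bot_iff]
  intro h hh
  have key : ∀ g : C(G, ℂ), inner ℂ (ContinuousMap.toLp 2 μ ℂ g) h = 0 := fun g => by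
    let gs : C(G, ℂ) := ⟨fun t => (starRingEnd ℂ) (g t⁻¹), by fun_prop⟩
    have h1 := inner_toLp_eq_zero_of_hermitian μ ρ hρ hh (g + gs) fun t => by
      simp [gs, add_comm]
    have h2 := inner_toLp_eq_zero_of_hermitian μ ρ hρ hh (Complex.I • (g - gs)) fun t => by
      simp [gs]
      ring
    rw [map_add, inner_add_left] at h1
    rw [map_smul, inner_smul_left, map_sub, inner_sub_left] at h2
    have h3 := (mul_eq_zero.1 h2).resolve_left (by simp)
    linear_combination (h1 + h3) / 2
  have := toLp_induction μ (p := fun g => inner ℂ g h = 0)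
    (isClosed_eq (by fun_prop) (by fun_prop)) key h
  exact inner_self_eq_zero.1 this

end PeterWeyl

/-! ### Fourier series in `L²` -/

section FourierSeries

theorem integral_norm_le_norm_toLp {X : Type*} [TopologicalSpace X] [CompactSpace X]
    [MeasurableSpace X] [BorelSpace X] (μ : Measure X) [IsProbabilityMeasure μ] (f : C(X, ℂ)) :
    ∫ x, ‖f x‖ ∂μ ≤ ‖ContinuousMap.toLp 2 μ ℂ f‖ := by
  have hm : AEStronglyMeasurable f μ := aestronglyMeasurable_of_continuous μ f f.continuous
  have h1 : ∫ x, ‖f x‖ ∂μ = (eLpNorm f 1 μ).toReal := by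
    rw [eLpNorm_one_eq_lintegral_enorm, integral_norm_eq_lintegral_enorm hm]
  have h2 : ‖ContinuousMap.toLp 2 μ ℂ f‖ = (eLpNorm f 2 μ).toReal := by
    rw [Lp.norm_def, eLpNorm_congr_ae (ContinuousMap.coeFn_toLp μ f)]
  rw [h1, h2]
  refine ENNReal.toReal_mono ?_ (eLpNorm_le_eLpNorm_of_exponent_le (by simp) hm)
  rw [← eLpNorm_congr_ae (ContinuousMap.coeFn_toLp (p := 2) (𝕜 := ℂ) μ f)]
  exact Lp.eLpNorm_ne_top _

variable {G : Type*} [Group G] [TopologicalSpace G] [CompactSpace G] [MeasurableSpace G]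
  [BorelSpace G] (μ : Measure G)

theorem isMulRightInvariant_of_isProbabilityMeasure [IsTopologicalGroup G] [IsProbabilityMeasure μ]
    [μ.IsHaarMeasure] : μ.IsMulRightInvariant where
  map_mul_right_eq_self g := by
    have : IsProbabilityMeasure (μ.map (· * g)) :=
      Measure.isProbabilityMeasure_map (by fun_prop)
    exact Measure.isHaarMeasure_eq_of_isProbabilityMeasure _ μ

/-- An orthonormal basis of the space of `ξ`. -/
noncomputable def UnitaryIrrep.basis {G : Type*} [Group G] [TopologicalSpace G]
    (ξ : UnitaryIrrep.{w} G) : OrthonormalBasis (Fin ξ.dim) ℂ ξ.space :=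
  stdOrthonormalBasis ℂ ξ.space

/-- The term `x ↦ dim(ξ) Tr(ξ(x) f̂(ξ))` of the Fourier series of `f`. -/
noncomputable def UnitaryIrrep.fourierTerm (ξ : UnitaryIrrep.{w} G) (f : G → ℂ) : C(G, ℂ) where
  toFun x := ξ.dim * LinearMap.trace ℂ ξ.space (ξ.op x * fourierCoefficient μ f ξ).toLinearMap
  continuous_toFun := by
    have := ξ.continuous_op
    simp_rw [LinearMap.trace_eq_sum_inner _ ξ.basis]
    simp only [ContinuousLinearMap.coe_coe, mul_apply_eq_comp]
    fun_prop

omit [CompactSpace G] [BorelSpace G] in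
theorem UnitaryIrrep.fourierTerm_apply (ξ : UnitaryIrrep.{w} G) (f : G → ℂ) (x : G) :
    ξ.fourierTerm μ f x = ξ.dim *
      LinearMap.trace ℂ ξ.space (ξ.op x * fourierCoefficient μ f ξ).toLinearMap := rfl

variable [IsProbabilityMeasure μ]

theorem UnitaryIrrep.integrable_smul_adjoint_op [IsTopologicalGroup G] (ξ : UnitaryIrrep.{w} G)
    {f : G → ℂ} (hf : Continuous f) :
    Integrable (fun x => f x • ContinuousLinearMap.adjoint (ξ.op x)) μ := by
  have := ξ.continuous_op
  simp_rw [ξ.adjoint_op]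
  exact integrable_of_continuous_of_compactSpace μ (by fun_prop)

theorem UnitaryIrrep.inner_fourierCoefficient [IsTopologicalGroup G] (ξ : UnitaryIrrep.{w} G)
    {f : G → ℂ} (hf : Continuous f) (u v : ξ.space) :
    inner ℂ v (fourierCoefficient μ f ξ u) =
      ∫ y, f y * (starRingEnd ℂ) (ξ.coefficient v u y) ∂μ := by
  rw [fourierCoefficient, ContinuousLinearMap.integral_apply (ξ.integrable_smul_adjoint_op μ hf),
    ← integral_inner ((ξ.integrable_smul_adjoint_op μ hf).apply_continuousLinearMap u)]
  refine integral_congr_ae (.of_forall fun y => ?_)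
  simp only [smul_apply, inner_smul_right, coefficient_apply, inner_conj_symm]
  rw [ContinuousLinearMap.adjoint_inner_right]

/-- The function `y ↦ dim(ξ) Tr(ξ(x) ξ(y)^*)`. -/
noncomputable def UnitaryIrrep.dirichletKernel [IsTopologicalGroup G] (ξ : UnitaryIrrep.{w} G)
    (x : G) : C(G, ℂ) where
  toFun y := ξ.dim * LinearMap.trace ℂ ξ.space (ξ.op x * ξ.op y⁻¹).toLinearMap
  continuous_toFun := by
    have := ξ.continuous_op
    simp_rw [LinearMap.trace_eq_sum_inner _ ξ.basis]
    simp only [ContinuousLinearMap.coe_coe, mul_apply_eq_comp]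
    fun_prop

theorem UnitaryIrrep.fourierTerm_eq_integral [IsTopologicalGroup G] (ξ : UnitaryIrrep.{w} G)
    {f : G → ℂ} (hf : Continuous f) (x : G) :
    ξ.fourierTerm μ f x = ∫ y, f y * ξ.dirichletKernel x y ∂μ := by
  let tr : (ξ.space →L[ℂ] ξ.space) →L[ℂ] ℂ := LinearMap.toContinuousLinearMap
    ((ξ.dim : ℂ) • LinearMap.trace ℂ ξ.space ∘ₗ ContinuousLinearMap.coeLM ℂ ∘ₗ
      LinearMap.mulLeft ℂ (ξ.op x))
  change tr (fourierCoefficient μ f ξ) = _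
  rw [fourierCoefficient, ← ContinuousLinearMap.integral_comp_comm tr
    (ξ.integrable_smul_adjoint_op μ hf)]
  refine integral_congr_ae (.of_forall fun y => ?_)
  simp only [map_smul, smul_eq_mul, ξ.adjoint_op]
  rfl

theorem UnitaryIrrep.fourierTerm_eq_sum [IsTopologicalGroup G] (ξ : UnitaryIrrep.{w} G)
    {f : G → ℂ} (hf : Continuous f) (x : G) :
    let b := ξ.basis
    ξ.fourierTerm μ f x = ξ.dim * ∑ p : Fin ξ.dim × Fin ξ.dim,
      (∫ y, f y * (starRingEnd ℂ) (ξ.coefficient (b p.2) (b p.1) y) ∂μ) *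
        ξ.coefficient (b p.2) (b p.1) x := by
  intro b
  rw [fourierTerm_apply, LinearMap.trace_eq_sum_inner _ b, Fintype.sum_prod_type]
  congr 1
  refine Finset.sum_congr rfl fun i _ => ?_
  simp_rw [← ξ.inner_fourierCoefficient μ hf, coefficient_apply]
  rw [ContinuousLinearMap.coe_coe, mul_apply_eq_comp, ← ContinuousLinearMap.adjoint_inner_left,
    ← b.sum_inner_mul_inner]
  refine Finset.sum_congr rfl fun j _ => ?_
  rw [ContinuousLinearMap.adjoint_inner_left, mul_comm]

variable (ρ : UnitaryDual.{w} G → UnitaryIrrep.{w} G)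

/-- The normalized matrix coefficients of the representations `ρ c`. -/
noncomputable def normalizedCoefficient
    (p : Σ c : UnitaryDual.{w} G, Fin (ρ c).dim × Fin (ρ c).dim) : Lp ℂ 2 μ :=
  (√(ρ p.1).dim : ℂ) • ContinuousMap.toLp 2 μ ℂ ((ρ p.1).coefficient
    ((ρ p.1).basis p.2.2) ((ρ p.1).basis p.2.1))

theorem orthonormal_normalizedCoefficient [IsTopologicalGroup G]
    [μ.IsMulLeftInvariant] (hρ : ∀ c, (ρ c).toDual = c) :
    Orthonormal ℂ (normalizedCoefficient μ ρ) := by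
  classical
  rw [orthonormal_iff_ite]
  rintro ⟨c, i, j⟩ ⟨c', i', j'⟩
  simp only [normalizedCoefficient]
  rw [inner_smul_left, inner_smul_right, ContinuousMap.inner_toLp]
  by_cases hc : c = c'
  · subst hc
    have h := (ρ c).dim_mul_integral_coefficient_mul_conj μ ((ρ c).basis j)
      ((ρ c).basis i) ((ρ c).basis j') ((ρ c).basis i')
    have hd : (starRingEnd ℂ) (√(ρ c).dim : ℂ) * (√(ρ c).dim : ℂ) = (ρ c).dim := by
      rw [Complex.conj_ofReal, ← Complex.ofReal_mul, Real.mul_self_sqrt (by positivity)]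
      simp
    rw [← mul_assoc, hd]
    refine h.trans ?_
    rw [orthonormal_iff_ite.1 (ρ c).basis.orthonormal,
      orthonormal_iff_ite.1 (ρ c).basis.orthonormal]
    by_cases h1 : i = i' <;> by_cases h2 : j = j' <;> simp [h1, h2, eq_comm]
  · rw [UnitaryIrrep.integral_coefficient_mul_conj_of_not_equiv, if_neg]
    · simp
    · intro h
      exact hc (congrArg Sigma.fst h)
    · intro h
      exact hc ((hρ c).symm.trans ((Quotient.sound h).trans (hρ c')))

theorem coefficientSpan_le_span_normalizedCoefficient :
    coefficientSpan μ ρ ≤ Submodule.span ℂ (range (normalizedCoefficient μ ρ)) := by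
  rw [coefficientSpan, Submodule.span_le]
  rintro _ ⟨c, u, v, rfl⟩
  set b := (ρ c).basis
  have hd : (√(ρ c).dim : ℂ) ≠ 0 := by
    have := (ρ c).nontrivial_space
    have : 0 < (ρ c).dim := Module.finrank_pos
    exact_mod_cast (Real.sqrt_pos.2 (by exact_mod_cast this)).ne'
  have e : (ρ c).coefficient u v = ∑ i, ∑ j, (inner ℂ (b j) u * inner ℂ v (b i)) •
      (ρ c).coefficient (b j) (b i) := by
    ext x
    simp only [ContinuousMap.sum_apply, ContinuousMap.smul_apply, UnitaryIrrep.coefficient_apply,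
      smul_eq_mul]
    rw [← b.sum_inner_mul_inner]
    refine Finset.sum_congr rfl fun i _ => ?_
    conv_lhs => rw [← b.sum_repr' u]
    simp only [map_sum, map_smul, inner_sum, inner_smul_right, Finset.mul_sum]
    exact Finset.sum_congr rfl fun j _ => by ring
  rw [e, map_sum]
  refine Submodule.sum_mem _ fun i _ => ?_
  rw [map_sum]
  refine Submodule.sum_mem _ fun j _ => ?_
  rw [map_smul]
  refine Submodule.smul_mem _ _ ?_
  rw [← inv_smul_smul₀ hd (ContinuousMap.toLp 2 μ ℂ _)]
  exact Submodule.smul_mem _ _ (Submodule.subset_span ⟨⟨c, i, j⟩, rfl⟩)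

variable [μ.IsMulLeftInvariant] [IsTopologicalGroup G] [μ.IsMulRightInvariant] [T2Space G]
  [SecondCountableTopology G] [μ.IsOpenPosMeasure]

/-- The Fourier series of a continuous function converges unconditionally in `L²`. -/
theorem hasSum_toLp_fourierTerm (hρ : ∀ c, (ρ c).toDual = c) (f : C(G, ℂ)) :
    HasSum (fun c => ContinuousMap.toLp 2 μ ℂ ((ρ c).fourierTerm μ f))
      (ContinuousMap.toLp 2 μ ℂ f) := by
  let B := HilbertBasis.mk (orthonormal_normalizedCoefficient μ ρ hρ) (by
    rw [← topologicalClosure_coefficientSpan μ ρ hρ]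
    exact Submodule.topologicalClosure_mono (coefficientSpan_le_span_normalizedCoefficient μ ρ))
  have h := (B.hasSum_repr (ContinuousMap.toLp 2 μ ℂ f)).sigma fun c => hasSum_fintype _
  convert h using 2 with c
  set b := (ρ c).basis
  have e : (ρ c).fourierTerm μ f = ∑ p : Fin (ρ c).dim × Fin (ρ c).dim, ((ρ c).dim *
      (∫ y, f y * (starRingEnd ℂ) ((ρ c).coefficient (b p.2) (b p.1) y) ∂μ)) •
        (ρ c).coefficient (b p.2) (b p.1) := by
    ext x
    rw [(ρ c).fourierTerm_eq_sum μ f.continuous, ContinuousMap.sum_apply, Finset.mul_sum]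
    exact Finset.sum_congr rfl fun p _ => by
      rw [ContinuousMap.smul_apply, smul_eq_mul, mul_assoc]
  rw [e, map_sum]
  refine Finset.sum_congr rfl fun p _ => ?_
  rw [HilbertBasis.repr_apply_apply, HilbertBasis.coe_mk, map_smul]
  simp only [normalizedCoefficient]
  rw [inner_smul_left, ContinuousMap.inner_toLp, smul_smul]
  congr 1
  have hd : (starRingEnd ℂ) (√(ρ c).dim : ℂ) * (√(ρ c).dim : ℂ) = (ρ c).dim := by
    rw [Complex.conj_ofReal, ← Complex.ofReal_mul, Real.mul_self_sqrt (by positivity)]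
    simp
  rw [← hd]
  ring

end FourierSeries

/-! ### Left-invariant derivatives on a Lie group -/

section InvariantDerivatives

variable {E H G : Type*} [NormedAddCommGroup E] [NormedSpace ℝ E]
  [TopologicalSpace H] (I : ModelWithCorners ℝ E H) [TopologicalSpace G] [ChartedSpace H G]

theorem tangentBundle_mk_eq_mk {x y : G} (u v : E) (h : x = y) (h' : u = v) :
    (⟨x, u⟩ : TangentBundle I G) = ⟨y, v⟩ := by
  subst h h'
  rfl

variable [Group G]

/-- The derivative of `f` along the left-invariant vector field with value `v` at `1`. -/
noncomputable def leftDeriv (v : E) (f : G → ℂ) (x : G) : ℂ :=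
  fderiv ℝ (fun p => f (x * (extChartAt I (1 : G)).symm p)) (extChartAt I (1 : G) 1) v

theorem leftDeriv_mul_left (v : E) (f : G → ℂ) (z x : G) :
    leftDeriv I v (fun y => f (z * y)) x = leftDeriv I v f (z * x) := by
  simp only [leftDeriv, mul_assoc]

variable [LieGroup I ∞ G]

/-- The map `(g, u), (h, v) ↦ (g h, d(· h)_g u + d(g ·)_h v)` of tangent bundles is smooth. -/
theorem contMDiff_tangentBundle_mul {M : Type*} [TopologicalSpace M] [ChartedSpace H M]
    (a b : M → G) (u v : M → E)
    (hu : ContMDiff I I.tangent ∞ fun x => (⟨a x, u x⟩ : TangentBundle I G))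
    (hv : ContMDiff I I.tangent ∞ fun x => (⟨b x, v x⟩ : TangentBundle I G)) :
    ContMDiff I I.tangent ∞ fun x => (⟨a x * b x, mfderiv I I (fun z => z * b x) (a x) (u x) +
      mfderiv I I (fun z => a x * z) (b x) (v x)⟩ : TangentBundle I G) := by
  have h0 : (∞ : WithTop ℕ∞) ≠ 0 := by simp
  have S₂ : ContMDiff (I.tangent.prod I.tangent) (I.prod I).tangent ∞
    (equivTangentBundleProd I G I G).symm := contMDiff_equivTangentBundleProd_symm
  have S₃ : ContMDiff (I.prod I).tangent I.tangent ∞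
      (tangentMap (I.prod I) I (fun p : G × G => p.1 * p.2)) :=
    (contMDiff_mul I ∞).contMDiff_tangentMap (m := ∞) (by simp)
  refine ((S₃.comp S₂).comp (hu.prodMk hv)).congr fun g => ?_
  simp only [Function.comp_apply, tangentMap]
  rw [mfderiv_prod_eq_add_apply ((contMDiff_mul I ∞).mdifferentiableAt h0)]
  rfl

theorem contMDiff_mulInvariantVectorField_infty (v : E) :
    ContMDiff I I.tangent ∞
      (fun g : G => (⟨g, mulInvariantVectorField (I := I) v g⟩ : TangentBundle I G)) := by
  refine (contMDiff_tangentBundle_mul I id (fun _ => (1 : G)) (fun _ => 0) (fun _ => v)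
    (Bundle.contMDiff_zeroSection ℝ (TangentSpace I : G → Type _)) contMDiff_const).congr
    fun g => tangentBundle_mk_eq_mk I _ _ (mul_one g).symm ?_
  exact ((congrArg (· + (mulInvariantVectorField (I := I) v g : E))
    (map_zero (mfderiv I I (fun z : G => z * 1) g))).trans (zero_add _)).symm

/-- The left-invariant vector field with value `v` at `1`. -/
noncomputable def leftInvariantField (v : E) : SmoothVectorField I G :=
  ⟨mulInvariantVectorField (I := I) (G := G) v, contMDiff_mulInvariantVectorField_infty I v⟩

/-- The Maurer–Cartan form applied to a vector field. -/
noncomputable def maurerCartan {I : ModelWithCorners ℝ E H} [LieGroup I ∞ G]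
    (X : SmoothVectorField I G) (x : G) : E :=
  mfderiv I I (fun y : G => x⁻¹ * y) x (X x)

variable {I} in
theorem contMDiff_maurerCartan (X : SmoothVectorField I G) :
    ContMDiff I 𝓘(ℝ, E) ∞ (maurerCartan X) := by
  have S : ContMDiff I I.tangent ∞ (fun g : G =>
      (⟨1, maurerCartan (E := E) X g⟩ : TangentBundle I G)) := by
    refine (contMDiff_tangentBundle_mul I (fun x : G => x⁻¹) id (fun _ => 0) (fun x => X x)
      ((Bundle.contMDiff_zeroSection ℝ (TangentSpace I : G → Type _)).comp
      (contMDiff_inv I ∞)) X.contMDiff).congr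
      fun g => tangentBundle_mk_eq_mk I _ _ (inv_mul_cancel g).symm ?_
    exact ((congrArg (· + maurerCartan (E := E) X g)
      (map_zero (mfderiv I I (fun z : G => z * g) g⁻¹))).trans (zero_add _)).symm
  intro x
  have h := (Bundle.contMDiffAt_totalSpace.1 (S x)).2
  refine h.congr_of_eventuallyEq (.of_forall fun g => ?_)
  have := FiberBundleCore.localTrivAt_apply_mk (tangentBundleCore I G).toFiberBundleCore 1
    (maurerCartan (E := E) X g)
  exact (congrArg Prod.snd this).symm

variable {I} in
theorem mulInvariantVectorField_maurerCartan (X : SmoothVectorField I G) (x : G) :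
    mulInvariantVectorField (I := I) (maurerCartan (E := E) X x) x = X x := by
  have h0 : (∞ : WithTop ℕ∞) ≠ 0 := by simp
  have h1 : mfderiv I I ((fun y : G => x * y) ∘ fun y => x⁻¹ * y) x =
      (mfderiv I I (fun y : G => x * y) (x⁻¹ * x)).comp (mfderiv I I (fun y : G => x⁻¹ * y) x) :=
    mfderiv_comp (I' := I) x ((contMDiff_mul_left (I := I) (n := ∞)).mdifferentiableAt h0)
      ((contMDiff_mul_left (I := I) (n := ∞)).mdifferentiableAt h0)
  have h2 : (fun y : G => x * y) ∘ (fun y => x⁻¹ * y) = id := by ext; simp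
  rw [h2, mfderiv_id, inv_mul_cancel] at h1
  exact (congrArg (fun T => T (X x)) h1).symm

variable [I.Boundaryless]

theorem mfderiv_mulInvariantVectorField (v : E) {f : G → ℂ} (hf : ContMDiff I 𝓘(ℝ, ℂ) ∞ f) (x : G) :
    mfderiv I 𝓘(ℝ, ℂ) f x (mulInvariantVectorField (I := I) v x) = leftDeriv I v f x := by
  have h0 : (∞ : WithTop ℕ∞) ≠ 0 := by simp
  have h1 : mfderiv I 𝓘(ℝ, ℂ) (f ∘ fun y => x * y) 1 =
      (mfderiv I 𝓘(ℝ, ℂ) f (x * 1)).comp (mfderiv I I (fun y => x * y) (1 : G)) :=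
    mfderiv_comp (I' := I) (1 : G) (hf.mdifferentiableAt h0)
      ((contMDiff_mul_left (I := I) (n := ∞)).mdifferentiableAt h0)
  have h2 : MDifferentiableAt I 𝓘(ℝ, ℂ) (f ∘ fun y => x * y) 1 :=
    (hf.comp (contMDiff_mul_left (I := I) (n := ∞))).mdifferentiableAt h0
  have h3 : mfderiv I 𝓘(ℝ, ℂ) (f ∘ fun y => x * y) 1 =
      fderivWithin ℝ (writtenInExtChartAt I 𝓘(ℝ, ℂ) (1 : G) (f ∘ fun y => x * y))
        (range I) (extChartAt I (1 : G) 1) := by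
    rw [mfderiv]
    exact if_pos h2
  rw [I.range_eq_univ, fderivWithin_univ, h1, mul_one] at h3
  exact congrArg (fun T => T v) h3

theorem derivAlong_leftInvariantField (v : E) {f : G → ℂ} (hf : ContMDiff I 𝓘(ℝ, ℂ) ∞ f) :
    derivAlong (leftInvariantField I v) f = leftDeriv I v f :=
  funext fun x => mfderiv_mulInvariantVectorField I v hf x

theorem contMDiff_leftDeriv (v : E) {f : G → ℂ} (hf : ContMDiff I 𝓘(ℝ, ℂ) ∞ f) :
    ContMDiff I 𝓘(ℝ, ℂ) ∞ (leftDeriv I v f) := by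
  rw [← derivAlong_leftInvariantField I v hf]
  exact contMDiff_derivAlong _ hf

variable {I} in
theorem derivAlong_eq_leftDeriv (X : SmoothVectorField I G) {f : G → ℂ}
    (hf : ContMDiff I 𝓘(ℝ, ℂ) ∞ f) (x : G) :
    derivAlong X f x = leftDeriv I (maurerCartan X x) f x := by
  rw [← mfderiv_mulInvariantVectorField I _ hf, mulInvariantVectorField_maurerCartan]
  rfl

variable {I} in
theorem derivAlong_eq_sum {ι : Type*} [Fintype ι] (b : Module.Basis ι ℝ E)
    (X : SmoothVectorField I G) {f : G → ℂ} (hf : ContMDiff I 𝓘(ℝ, ℂ) ∞ f) (x : G) :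
    derivAlong X f x = ∑ i, (b.repr (maurerCartan X x) i : ℂ) * leftDeriv I (b i) f x := by
  rw [derivAlong_eq_leftDeriv X hf]
  conv_lhs => rw [← b.sum_repr (maurerCartan X x)]
  simp only [leftDeriv, map_sum, map_smul, Complex.real_smul]

end InvariantDerivatives

/-! ### Differential operators in terms of left-invariant derivatives -/

section LeftDiffOp

variable {E H G : Type*} [NormedAddCommGroup E] [NormedSpace ℝ E]
  [TopologicalSpace H] (I : ModelWithCorners ℝ E H) [TopologicalSpace G] [ChartedSpace H G]
  [Group G]

/-- The iterated left-invariant derivative along basis vectors. -/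
noncomputable def iterLeftDeriv {ι : Type*} (b : ι → E) (L : List ι) (f : G → ℂ) : G → ℂ :=
  L.foldr (fun i => leftDeriv I (b i)) f

theorem iterLeftDeriv_cons {ι : Type*} (b : ι → E) (i : ι) (L : List ι) (f : G → ℂ) :
    iterLeftDeriv I b (i :: L) f = leftDeriv I (b i) (iterLeftDeriv I b L f) := rfl

theorem iterLeftDeriv_mul_left {ι : Type*} (b : ι → E) (L : List ι) (f : G → ℂ) (z : G) :
    iterLeftDeriv I b L (fun y => f (z * y)) = fun y => iterLeftDeriv I b L f (z * y) := by
  induction L with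
  | nil => rfl
  | cons i L ih =>
    rw [iterLeftDeriv_cons, ih]
    exact funext fun x => leftDeriv_mul_left I _ _ z x

variable [I.Boundaryless] [LieGroup I ∞ G]

theorem contMDiff_iterLeftDeriv {ι : Type*} (b : ι → E) (L : List ι) {f : G → ℂ}
    (hf : ContMDiff I 𝓘(ℝ, ℂ) ∞ f) : ContMDiff I 𝓘(ℝ, ℂ) ∞ (iterLeftDeriv I b L f) := by
  induction L with
  | nil => exact hf
  | cons i L ih => exact contMDiff_leftDeriv I _ ih

omit [I.Boundaryless] in
theorem contMDiffOn_comp_mul_extChartAt_symm {V : Type*} [NormedAddCommGroup V] [NormedSpace ℝ V]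
    {f : G → V} (hf : ContMDiff I 𝓘(ℝ, V) ∞ f) :
    ContMDiffOn (𝓘(ℝ, E).prod I) 𝓘(ℝ, V) ∞
      (Function.uncurry fun (p : E) (y : G) => f (y * (extChartAt I (1 : G)).symm p))
      ((extChartAt I (1 : G)).target ×ˢ univ) := by
  refine hf.comp_contMDiffOn ?_
  have h1 : ContMDiffOn (𝓘(ℝ, E).prod I) I ∞ (fun p : E × G => (extChartAt I (1 : G)).symm p.1)
      ((extChartAt I (1 : G)).target ×ˢ univ) :=
    (contMDiffOn_extChartAt_symm (I := I) (n := ∞) (1 : G)).comp contMDiff_fst.contMDiffOn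
      (fun q hq => hq.1)
  exact contMDiff_snd.contMDiffOn.mul h1

omit [I.Boundaryless] in
theorem contDiffOn_comp_mul_extChartAt_symm {V : Type*} [NormedAddCommGroup V] [NormedSpace ℝ V]
    {f : G → V} (hf : ContMDiff I 𝓘(ℝ, V) ∞ f) (x : G) :
    ContDiffOn ℝ ∞ (fun p => f (x * (extChartAt I (1 : G)).symm p))
      (extChartAt I (1 : G)).target := by
  rw [← contMDiffOn_iff_contDiffOn]
  exact (contMDiffOn_comp_mul_extChartAt_symm I hf).comp (f := fun p : E => (p, x))
    (contMDiff_id.prodMk contMDiff_const).contMDiffOn (fun p hp => ⟨hp, mem_univ _⟩)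

theorem differentiableAt_comp_mul_extChartAt_symm {V : Type*} [NormedAddCommGroup V]
    [NormedSpace ℝ V] {f : G → V} (hf : ContMDiff I 𝓘(ℝ, V) ∞ f) (x : G) :
    DifferentiableAt ℝ (fun p => f (x * (extChartAt I (1 : G)).symm p)) (extChartAt I (1 : G) 1) :=
  ((contDiffOn_comp_mul_extChartAt_symm I hf x).contDiffAt ((isOpen_extChartAt_target _).mem_nhds
    (mem_extChartAt_target _))).differentiableAt (by simp)

theorem leftDeriv_mul (v : E) {f g : G → ℂ} (hf : ContMDiff I 𝓘(ℝ, ℂ) ∞ f)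
    (hg : ContMDiff I 𝓘(ℝ, ℂ) ∞ g) (x : G) :
    leftDeriv I v (fun y => f y * g y) x = leftDeriv I v f x * g x + f x * leftDeriv I v g x := by
  have h := fderiv_fun_mul (differentiableAt_comp_mul_extChartAt_symm I hf x)
    (differentiableAt_comp_mul_extChartAt_symm I hg x)
  rw [leftDeriv, h]
  simp only [leftDeriv, extChartAt_to_inv, mul_one, add_apply, smul_apply, smul_eq_mul]
  ring

theorem leftDeriv_add (v : E) {f g : G → ℂ} (hf : ContMDiff I 𝓘(ℝ, ℂ) ∞ f)
    (hg : ContMDiff I 𝓘(ℝ, ℂ) ∞ g) (x : G) :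
    leftDeriv I v (fun y => f y + g y) x = leftDeriv I v f x + leftDeriv I v g x := by
  have h := fderiv_fun_add (differentiableAt_comp_mul_extChartAt_symm I hf x)
    (differentiableAt_comp_mul_extChartAt_symm I hg x)
  rw [leftDeriv, h]
  rfl

/-- Operators of the form `f ↦ ∑ a_L D_L f` with smooth coefficients `a_L` and iterated
left-invariant derivatives `D_L`. -/
inductive IsLeftDiffOp {ι : Type*} (b : ι → E) : ((G → ℂ) → G → ℂ) → Prop
  | mul (a : G → ℂ) (ha : ContMDiff I 𝓘(ℝ, ℂ) ∞ a) (L : List ι) :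
      IsLeftDiffOp b fun f x => a x * iterLeftDeriv I b L f x
  | add (P Q : (G → ℂ) → G → ℂ) (hP : IsLeftDiffOp b P) (hQ : IsLeftDiffOp b Q) :
      IsLeftDiffOp b fun f x => P f x + Q f x
  | congr (P Q : (G → ℂ) → G → ℂ) (hP : IsLeftDiffOp b P)
      (h : ∀ f, ContMDiff I 𝓘(ℝ, ℂ) ∞ f → ∀ x, Q f x = P f x) : IsLeftDiffOp b Q

namespace IsLeftDiffOp

variable {I} {ι : Type*} {b : ι → E} {P : (G → ℂ) → G → ℂ}

theorem contMDiff (hP : IsLeftDiffOp I b P) {f : G → ℂ} (hf : ContMDiff I 𝓘(ℝ, ℂ) ∞ f) :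
    ContMDiff I 𝓘(ℝ, ℂ) ∞ (P f) := by
  induction hP with
  | mul a ha L =>
    exact (contDiff_mul (𝕜 := ℝ) (𝔸 := ℂ) (n := ∞)).contMDiff.comp
      (ha.prodMk_space (contMDiff_iterLeftDeriv I b L hf))
  | add P Q _ _ hP hQ => exact hP.add hQ
  | congr P Q _ h hP => exact hP.congr (h f hf)

omit [I.Boundaryless] [LieGroup I ∞ G] in
theorem sum {κ : Type*} (s : Finset κ) (Q : κ → (G → ℂ) → G → ℂ)
    (hQ : ∀ k ∈ s, IsLeftDiffOp I b (Q k)) : IsLeftDiffOp I b fun f x => ∑ k ∈ s, Q k f x := by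
  classical
  induction s using Finset.induction_on with
  | empty => exact congr _ _ (mul (fun _ => 0) contMDiff_const []) (by simp)
  | insert k s hk ih =>
    refine congr _ _ (add _ _ (hQ k (Finset.mem_insert_self k s))
      (ih fun j hj => hQ j (Finset.mem_insert_of_mem hj))) fun f _ x => ?_
    rw [Finset.sum_insert hk]

omit [I.Boundaryless] [LieGroup I ∞ G] in
theorem mul_left {a : G → ℂ} (ha : ContMDiff I 𝓘(ℝ, ℂ) ∞ a) (hP : IsLeftDiffOp I b P) :
    IsLeftDiffOp I b fun f x => a x * P f x := by
  induction hP with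
  | mul a' ha' L =>
    refine congr _ _ (mul (fun x => a x * a' x) ?_ L) fun f _ x => (mul_assoc _ _ _).symm
    exact (contDiff_mul (𝕜 := ℝ) (𝔸 := ℂ) (n := ∞)).contMDiff.comp (ha.prodMk_space ha')
  | add P Q _ _ hP hQ => exact congr _ _ (add _ _ hP hQ) fun f _ x => mul_add _ _ _
  | congr P Q _ h hP => exact congr _ _ hP fun f hf x => by rw [h f hf]

theorem derivAlong {ι : Type*} [Fintype ι] {b : Module.Basis ι ℝ E} {P : (G → ℂ) → G → ℂ}
    [FiniteDimensional ℝ E] (X : SmoothVectorField I G) (hP : IsLeftDiffOp I b P) :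
    IsLeftDiffOp I b fun f => derivAlong X (P f) := by
  have hc : ∀ i, ContMDiff I 𝓘(ℝ, ℂ) ∞ fun x => (b.repr (maurerCartan X x) i : ℂ) := fun i =>
    (Complex.ofRealCLM ∘L LinearMap.toContinuousLinearMap (b.coord i)).contMDiff.comp
      (contMDiff_maurerCartan X)
  have key : ∀ i, IsLeftDiffOp I b fun f x => leftDeriv I (b i) (P f) x := by
    intro i
    induction hP with
    | mul a ha L =>
      exact congr _ _ (add _ _ (mul _ (contMDiff_leftDeriv I (b i) ha) L) (mul a ha (i :: L)))
        fun f hf x => leftDeriv_mul I _ ha (contMDiff_iterLeftDeriv I b L hf) x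
    | add P Q hP hQ ihP ihQ =>
      exact congr _ _ (add _ _ ihP ihQ) fun f hf x =>
        leftDeriv_add I _ (hP.contMDiff hf) (hQ.contMDiff hf) x
    | congr P Q _ h ih => exact congr _ _ ih fun f hf x => by rw [funext (h f hf)]
  exact congr _ _ (sum Finset.univ _ fun i _ => (key i).mul_left (hc i)) fun f hf x =>
    derivAlong_eq_sum b X (hP.contMDiff hf) x

theorem iterDerivAlong {ι : Type*} [Fintype ι] (b : Module.Basis ι ℝ E)
    [FiniteDimensional ℝ E] (L : List (SmoothVectorField I G)) {P : (G → ℂ) → G → ℂ}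
    (hP : IsLeftDiffOp I b P) : IsLeftDiffOp I b fun f => iterDerivAlong L (P f) := by
  induction L with
  | nil => exact hP
  | cons X L ih => exact ih.derivAlong X

omit [I.Boundaryless] [LieGroup I ∞ G] in
theorem exists_norm_le [CompactSpace G] (hP : IsLeftDiffOp I b P) :
    ∃ (C : ℝ) (S : Finset (List ι)), 0 ≤ C ∧ ∀ f, ContMDiff I 𝓘(ℝ, ℂ) ∞ f → ∀ x,
      ‖P f x‖ ≤ C * ∑ L ∈ S, ‖iterLeftDeriv I b L f x‖ := by
  classical
  induction hP with
  | mul a ha L =>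
    obtain ⟨C, hC⟩ := isCompact_univ.exists_bound_of_continuousOn ha.continuous.continuousOn
    refine ⟨max C 0, {L}, le_max_right _ _, fun f _ x => ?_⟩
    rw [norm_mul, Finset.sum_singleton]
    gcongr
    exact (hC x (mem_univ x)).trans (le_max_left _ _)
  | add P Q _ _ hP hQ =>
    obtain ⟨C, S, hC, h⟩ := hP
    obtain ⟨C', S', hC', h'⟩ := hQ
    refine ⟨C + C', S ∪ S', by positivity, fun f hf x => ?_⟩
    calc ‖P f x + Q f x‖ ≤ ‖P f x‖ + ‖Q f x‖ := norm_add_le _ _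
      _ ≤ C * ∑ L ∈ S ∪ S', ‖iterLeftDeriv I b L f x‖ +
          C' * ∑ L ∈ S ∪ S', ‖iterLeftDeriv I b L f x‖ := by
        refine add_le_add ((h f hf x).trans ?_) ((h' f hf x).trans ?_)
        · gcongr
          exact Finset.subset_union_left
        · gcongr
          exact Finset.subset_union_right
      _ = _ := by ring
  | congr P Q _ h hP =>
    obtain ⟨C, S, hC, h'⟩ := hP
    exact ⟨C, S, hC, fun f hf x => by rw [h f hf]; exact h' f hf x⟩

end IsLeftDiffOp

end LeftDiffOp

section LeftDerivIntegral

variable {E H G : Type*} [NormedAddCommGroup E] [NormedSpace ℝ E] [FiniteDimensional ℝ E]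
  [TopologicalSpace H] (I : ModelWithCorners ℝ E H) [TopologicalSpace G] [ChartedSpace H G]
  [Group G] [I.Boundaryless] [LieGroup I ∞ G] [CompactSpace G] [MeasurableSpace G] [BorelSpace G]
  (μ : Measure G) [IsFiniteMeasure μ]

theorem hasFDerivAt_integral_comp_mul_smul (f : G → ℝ) (hf : ContMDiff I 𝓘(ℝ, ℝ) ∞ f) (q : G → ℂ)
    (hq : Continuous q) :
    Integrable (fun y => fderiv ℝ (fun p => f (y * (extChartAt I (1 : G)).symm p) • q y)
      (extChartAt I (1 : G) 1)) μ ∧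
    HasFDerivAt (fun p => ∫ y, f (y * (extChartAt I (1 : G)).symm p) • q y ∂μ)
      (∫ y, fderiv ℝ (fun p => f (y * (extChartAt I (1 : G)).symm p) • q y)
        (extChartAt I (1 : G) 1) ∂μ) (extChartAt I (1 : G) 1) := by
  set p₀ := extChartAt I (1 : G) 1
  set U := (extChartAt I (1 : G)).target
  have hU : IsOpen U := isOpen_extChartAt_target (I := I) (1 : G)
  have hp₀ : p₀ ∈ U := mem_extChartAt_target (I := I) (1 : G)
  set F : E → G → ℂ := fun p y => f (y * (extChartAt I (1 : G)).symm p) • q y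
  have hF : ∀ y, ContDiffOn ℝ ∞ (fun p => F p y) U := fun y =>
    (contDiffOn_comp_mul_extChartAt_symm I hf y).smul contDiffOn_const
  have hk := continuousOn_iteratedFDeriv_of_contMDiffOn I _ U hU
    (contMDiffOn_comp_mul_extChartAt_symm I hf) q hq
  have hc : ∀ k : ℕ, ∀ p ∈ U, Continuous fun y => iteratedFDeriv ℝ k (fun p => F p y) p :=
    fun k p hp => (hk k).comp_continuous (f := fun y => (p, y)) (by fun_prop)
      (fun y => ⟨hp, mem_univ _⟩)
  have hFc : ∀ p ∈ U, Continuous (F p) := fun p hp =>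
    ((continuousMultilinearCurryFin0 ℝ E ℂ).continuous.comp (hc 0 p hp))
  obtain ⟨r, hr, hrU⟩ := Metric.nhds_basis_closedBall.mem_iff.1 (hU.mem_nhds hp₀)
  obtain ⟨C, hC⟩ := ((isCompact_closedBall p₀ r).prod isCompact_univ).exists_bound_of_continuousOn
    ((hk 1).mono (prod_mono hrU (subset_univ _)))
  have hc1 : Continuous fun y => fderiv ℝ (fun p => F p y) p₀ := by
    refine ((continuousMultilinearCurryFin1 ℝ E ℂ).continuous.comp (hc 1 p₀ hp₀)).congr fun y => ?_
    ext v
    simp [iteratedFDeriv_one_apply]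
  refine ⟨integrable_of_continuous_of_compactSpace μ hc1, ?_⟩
  refine hasFDerivAt_integral_of_dominated_of_fderiv_le (F := F) (bound := fun _ => C)
    (F' := fun p y => fderiv ℝ (fun p => F p y) p) (Metric.closedBall_mem_nhds p₀ hr) ?_ ?_ ?_ ?_
    (integrable_const C) ?_
  · filter_upwards [hU.mem_nhds hp₀] with p hp
    exact aestronglyMeasurable_of_continuous μ _ (hFc p hp)
  · exact integrable_of_continuous_of_compactSpace μ (hFc p₀ hp₀)
  · exact aestronglyMeasurable_of_continuous μ _ hc1
  · refine .of_forall fun y p hp => ?_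
    rw [← norm_iteratedFDeriv_one]
    exact hC (p, y) ⟨hp, mem_univ _⟩
  · refine .of_forall fun y p hp => ?_
    exact (((hF y).contDiffAt (hU.mem_nhds (hrU hp))).differentiableAt (by simp)).hasFDerivAt

theorem fderiv_integral_comp_mul (v : E) (f : G → ℂ) (hf : ContMDiff I 𝓘(ℝ, ℂ) ∞ f)
    (q : G → ℂ) (hq : Continuous q) :
    fderiv ℝ (fun p => ∫ y, f (y * (extChartAt I (1 : G)).symm p) * q y ∂μ)
      (extChartAt I (1 : G) 1) v = ∫ y, leftDeriv I v f y * q y ∂μ := by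
  have hre : ContMDiff I 𝓘(ℝ, ℝ) ∞ fun x => (f x).re := Complex.reCLM.contMDiff.comp hf
  have him : ContMDiff I 𝓘(ℝ, ℝ) ∞ fun x => (f x).im := Complex.imCLM.contMDiff.comp hf
  have hq' : Continuous fun y => Complex.I * q y := by fun_prop
  obtain ⟨i1, h1⟩ := hasFDerivAt_integral_comp_mul_smul I μ _ hre q hq
  obtain ⟨i2, h2⟩ := hasFDerivAt_integral_comp_mul_smul I μ _ him _ hq'
  have hsplit : ∀ z w : ℂ, z * w = z.re • w + z.im • (Complex.I * w) := fun z w => by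
    conv_lhs => rw [← Complex.re_add_im z]
    simp only [Complex.real_smul]
    ring
  have hsum : (fun p => ∫ y, f (y * (extChartAt I (1 : G)).symm p) * q y ∂μ) = fun p =>
      (∫ y, (f (y * (extChartAt I (1 : G)).symm p)).re • q y ∂μ) +
        ∫ y, (f (y * (extChartAt I (1 : G)).symm p)).im • (Complex.I * q y) ∂μ := by
    funext p
    have := topologicalGroup_of_lieGroup I ∞ (G := G)
    have c := hf.continuous
    rw [← integral_add (integrable_of_continuous_of_compactSpace μ (by fun_prop))
      (integrable_of_continuous_of_compactSpace μ (by fun_prop))]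
    exact integral_congr_ae (.of_forall fun y => hsplit _ _)
  rw [hsum, (h1.fun_add h2).fderiv, add_apply, ContinuousLinearMap.integral_apply i1,
    ContinuousLinearMap.integral_apply i2, ← integral_add (i1.apply_continuousLinearMap v)
      (i2.apply_continuousLinearMap v)]
  refine integral_congr_ae (.of_forall fun y => ?_)
  have d1 := (differentiableAt_comp_mul_extChartAt_symm I hre y).smul_const (q y)
  have d2 := (differentiableAt_comp_mul_extChartAt_symm I him y).smul_const (Complex.I * q y)
  have d := differentiableAt_comp_mul_extChartAt_symm I hf y
  have e := (d.hasFDerivAt.mul_const (q y)).fderiv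
  rw [funext fun p => hsplit (f (y * (extChartAt I (1 : G)).symm p)) (q y),
    fderiv_fun_add d1 d2] at e
  refine (congrArg (fun T => T v) e).trans ?_
  simp [leftDeriv, mul_comm]

end LeftDerivIntegral

/-! ### A Sobolev inequality in Euclidean space -/

section EuclideanSobolev

open scoped FourierTransform LineDeriv SchwartzMap

theorem norm_fourier_mul_pow_le {V : Type*} [NormedAddCommGroup V] [InnerProductSpace ℝ V]
    [FiniteDimensional ℝ V] [MeasurableSpace V] [BorelSpace V] (v : V) (m : ℕ) (g : 𝓢(V, ℂ))
    (x : V) : |inner ℝ x v| ^ m * ‖𝓕 g x‖ ≤ ∫ y, ‖((fun f : 𝓢(V, ℂ) => ∂_{v} f)^[m] g) y‖ := by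
  induction m generalizing g with
  | zero =>
    have h := SchwartzMap.norm_fourier_apply_le_toLp_one g x
    rw [SchwartzMap.norm_toLp_one] at h
    simpa using h
  | succ m ih =>
    have h := ih (∂_{v} g)
    rw [Function.iterate_succ_apply]
    refine le_trans ?_ h
    rw [SchwartzMap.fourier_lineDerivOp_eq]
    have ht : (fun x : V => inner ℝ x v).HasTemperateGrowth := by fun_prop
    rw [smul_apply, SchwartzMap.smulLeftCLM_apply_apply ht, norm_smul,
      norm_smul, pow_succ, mul_assoc, Real.norm_eq_abs]
    refine mul_le_mul_of_nonneg_left ?_ (by positivity)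
    refine le_mul_of_one_le_left (by positivity : 0 ≤ |inner ℝ x v| * ‖𝓕 g x‖) ?_
    simp only [norm_mul, Complex.norm_ofNat, Complex.norm_real, Complex.norm_I, mul_one,
      Real.norm_of_nonneg Real.pi_pos.le]
    nlinarith [Real.pi_gt_three]

theorem norm_le_integral_norm_fourier {V : Type*} [NormedAddCommGroup V] [InnerProductSpace ℝ V]
    [FiniteDimensional ℝ V] [MeasurableSpace V] [BorelSpace V] (g : 𝓢(V, ℂ)) (x : V) :
    ‖g x‖ ≤ ∫ y, ‖𝓕 g y‖ := by
  have h := SchwartzMap.norm_fourier_apply_le_toLp_one (𝓕 g) (-x)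
  rw [SchwartzMap.norm_toLp_one] at h
  have e : 𝓕⁻ (𝓕 g) x = 𝓕 (𝓕 g) (-x) := rfl
  rwa [← e, FourierPair.fourierInv_fourier_eq] at h

/-- The number `n + 1` of derivatives controls the supremum of a function on `ℝⁿ`. -/
theorem exists_norm_le_integral_lineDeriv (n : ℕ) :
    ∃ C : ℝ, 0 ≤ C ∧ ∀ (g : 𝓢(EuclideanSpace ℝ (Fin n), ℂ)) (x : EuclideanSpace ℝ (Fin n)),
      ‖g x‖ ≤ C * ((∫ y, ‖g y‖) + ∑ i : Fin n, ∫ y, ‖((fun f : 𝓢(EuclideanSpace ℝ (Fin n), ℂ) =>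
        ∂_{EuclideanSpace.single i (1 : ℝ)} f)^[n + 1] g) y‖) := by
  let V := EuclideanSpace ℝ (Fin n)
  have hint : Integrable fun x : V => (1 + ‖x‖) ^ (-((n + 1 : ℕ) : ℝ)) :=
    integrable_one_add_norm (by simp [V])
  set B : ℝ := ∫ x : V, (1 + ‖x‖) ^ (-((n + 1 : ℕ) : ℝ))
  have hB : 0 ≤ B := integral_nonneg fun x => by positivity
  refine ⟨(n + 1) ^ n * B, by positivity, fun g x => ?_⟩
  set N : ℝ := (∫ y, ‖g y‖) + ∑ i : Fin n, ∫ y, ‖((fun f : 𝓢(EuclideanSpace ℝ (Fin n), ℂ) =>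
        ∂_{EuclideanSpace.single i (1 : ℝ)} f)^[n + 1] g) y‖
  have key : ∀ y : V, ‖𝓕 g y‖ ≤ (n + 1) ^ n * N * (1 + ‖y‖) ^ (-((n + 1 : ℕ) : ℝ)) := by
    intro y
    have h1 : (1 + ∑ i, |y i| ^ (n + 1)) * ‖𝓕 g y‖ ≤ N := by
      rw [add_mul, Finset.sum_mul]
      refine add_le_add ?_ (Finset.sum_le_sum fun i _ => ?_)
      · simpa using norm_fourier_mul_pow_le (0 : V) 0 g y
      · simpa [EuclideanSpace.inner_single_right] using
          norm_fourier_mul_pow_le (EuclideanSpace.single i (1 : ℝ)) (n + 1) g y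
    have h2 : 1 + ‖y‖ ≤ 1 + ∑ i, |y i| := by
      gcongr
      conv_lhs => rw [← (EuclideanSpace.basisFun (Fin n) ℝ).sum_repr y]
      refine (norm_sum_le _ _).trans (Finset.sum_le_sum fun i _ => ?_)
      rw [norm_smul, (EuclideanSpace.basisFun (Fin n) ℝ).norm_eq_one, mul_one]
      rfl
    have h3 : (1 + ∑ i, |y i|) ^ (n + 1) ≤ (n + 1) ^ n * (1 + ∑ i, |y i| ^ (n + 1)) := by
      have h := pow_sum_div_card_le_sum_pow (s := (Finset.univ : Finset (Option (Fin n))))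
        (f := fun o => o.elim 1 fun i => |y i|) (by rintro (_ | i) _ <;> simp) n
      rw [Fintype.sum_option, Fintype.sum_option, div_le_iff₀ (by simp; positivity)] at h
      simp only [Option.elim, one_pow, Finset.card_univ, Fintype.card_option, Fintype.card_fin,
        Nat.cast_add, Nat.cast_one] at h
      linarith
    have hp : 0 < (1 + ‖y‖) ^ (n + 1) := by positivity
    rw [Real.rpow_neg (by positivity), Real.rpow_natCast, ← div_eq_mul_inv, le_div_iff₀ hp]
    calc ‖𝓕 g y‖ * (1 + ‖y‖) ^ (n + 1)
        ≤ ‖𝓕 g y‖ * ((n + 1) ^ n * (1 + ∑ i, |y i| ^ (n + 1))) := by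
          gcongr
          exact (pow_le_pow_left₀ (by positivity) h2 _).trans h3
      _ = (n + 1) ^ n * ((1 + ∑ i, |y i| ^ (n + 1)) * ‖𝓕 g y‖) := by ring
      _ ≤ (n + 1) ^ n * N := by gcongr
  calc ‖g x‖ ≤ ∫ y, ‖𝓕 g y‖ := norm_le_integral_norm_fourier g x
    _ ≤ ∫ y : V, (n + 1) ^ n * N * (1 + ‖y‖) ^ (-((n + 1 : ℕ) : ℝ)) :=
        integral_mono (𝓕 g).integrable.norm (hint.const_mul _) key
    _ = (n + 1) ^ n * B * N := by rw [integral_const_mul]; ring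

/-- A Sobolev inequality on a finite-dimensional space with coordinates `e`. -/
theorem exists_norm_le_integral_fderiv {E : Type*} [NormedAddCommGroup E] [NormedSpace ℝ E]
    {n : ℕ} (e : EuclideanSpace ℝ (Fin n) ≃L[ℝ] E) :
    ∃ C : ℝ, 0 ≤ C ∧ ∀ h : E → ℂ, ContDiff ℝ ∞ h → HasCompactSupport h → ∀ x,
      ‖h x‖ ≤ C * ((∫ y, ‖h (e y)‖) + ∑ i : Fin n, ∫ y, ‖((fun (f : E → ℂ) p =>
        fderiv ℝ f p (e (EuclideanSpace.single i 1)))^[n + 1] h) (e y)‖) := by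
  obtain ⟨C, hC0, hC⟩ := exists_norm_le_integral_lineDeriv n
  refine ⟨C, hC0, fun h hh hs x => ?_⟩
  have hs' : HasCompactSupport (h ∘ e) := hs.comp_homeomorph e.toHomeomorph
  have hh' : ContDiff ℝ ∞ (h ∘ e) := hh.comp e.contDiff
  set g := hs'.toSchwartzMap hh'
  have key : ∀ (v : EuclideanSpace ℝ (Fin n)) (m : ℕ) (h : E → ℂ) (_ : ContDiff ℝ ∞ h)
      (g : 𝓢(EuclideanSpace ℝ (Fin n), ℂ)) (_ : ∀ y, g y = h (e y)) (y),
      ((fun f : 𝓢(EuclideanSpace ℝ (Fin n), ℂ) => ∂_{v} f)^[m] g) y =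
        ((fun (f : E → ℂ) p => fderiv ℝ f p (e v))^[m] h) (e y) := by
    intro v m
    induction m with
    | zero => intro h _ g hg y; exact hg y
    | succ m ih =>
      intro h hh g hg y
      rw [Function.iterate_succ_apply, Function.iterate_succ_apply]
      refine ih _ ?_ _ (fun y => ?_) y
      · exact (hh.fderiv_right (m := ∞) (by simp)).clm_apply contDiff_const
      · rw [SchwartzMap.lineDerivOp_apply_eq_fderiv]
        have : (g : EuclideanSpace ℝ (Fin n) → ℂ) = h ∘ e := funext hg
        rw [this, ContinuousLinearEquiv.comp_right_fderiv]
        rfl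
  have := hC g (e.symm x)
  simp_rw [key _ _ h hh g (fun y => rfl)] at this
  have e1 : ∀ y, g y = h (e y) := fun y => rfl
  simpa only [e1, e.apply_symm_apply] using this

end EuclideanSobolev

/-! ### A Sobolev inequality on a compact Lie group -/

section CoordinateFields

variable {E H M : Type*} [NormedAddCommGroup E] [NormedSpace ℝ E] [FiniteDimensional ℝ E]
  [TopologicalSpace H] (I : ModelWithCorners ℝ E H) [I.Boundaryless] [TopologicalSpace M]
  [ChartedSpace H M] [IsManifold I ∞ M]

omit [FiniteDimensional ℝ E] in
theorem derivAlong_localFrame (x₀ : M) {ι : Type*} (b : Module.Basis ι ℝ E) (i : ι) {g : M → ℂ}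
    (hg : ContMDiff I 𝓘(ℝ, ℂ) ∞ g) {y : M} (hy : y ∈ (chartAt H x₀).source) :
    mfderiv I 𝓘(ℝ, ℂ) g y ((trivializationAt E (TangentSpace I) x₀).localFrame b i y) =
      fderiv ℝ (g ∘ (extChartAt I x₀).symm) (extChartAt I x₀ y) (b i) := by
  have h0 : (∞ : WithTop ℕ∞) ≠ 0 := by simp
  have hy' : y ∈ (extChartAt I x₀).source := by rwa [extChartAt_source]
  have hyt : extChartAt I x₀ y ∈ (extChartAt I x₀).target := (extChartAt I x₀).map_source hy'
  have hb : y ∈ (trivializationAt E (TangentSpace I) x₀).baseSet := by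
    rwa [TangentBundle.trivializationAt_baseSet]
  have e1 : (trivializationAt E (TangentSpace I) x₀).localFrame b i y =
      mfderiv 𝓘(ℝ, E) I (extChartAt I x₀).symm (extChartAt I x₀ y) (b i) := by
    have h1 := TangentBundle.symmL_trivializationAt (I := I) hy
    rw [I.range_eq_univ, mfderivWithin_univ] at h1
    rw [Bundle.Trivialization.localFrame_apply_of_mem_baseSet _ _ hb]
    refine Eq.trans ?_ (congrArg (fun T => T (b i)) h1)
    simp [Bundle.Trivialization.basisAt]
    exact (Bundle.Trivialization.symmL_apply _ hb _).symm
  have hs : MDifferentiableAt 𝓘(ℝ, E) I (extChartAt I x₀).symm (extChartAt I x₀ y) :=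
    ((contMDiffOn_extChartAt_symm (I := I) (n := ∞) x₀).contMDiffAt
      ((isOpen_extChartAt_target x₀).mem_nhds hyt)).mdifferentiableAt h0
  have h2 := mfderiv_comp (I' := I) (extChartAt I x₀ y) (hg.mdifferentiableAt h0) hs
  rw [mfderiv_eq_fderiv, (extChartAt I x₀).left_inv hy'] at h2
  rw [e1]
  exact (congrArg (fun T => T (b i)) h2).symm

/-- Coordinate vector fields of a chart extend, near the center of the chart, to smooth vector
fields. -/
theorem exists_coordinate_vectorField [T2Space M] (x₀ : M) {ι : Type*} [Fintype ι]
    (b : Module.Basis ι ℝ E) :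
    ∃ O : Set M, IsOpen O ∧ x₀ ∈ O ∧ O ⊆ (extChartAt I x₀).source ∧ ∀ i,
      ∃ X : SmoothVectorField I M, ∀ g : M → ℂ, ContMDiff I 𝓘(ℝ, ℂ) ∞ g → ∀ y ∈ O,
        derivAlong X g y = fderiv ℝ (g ∘ (extChartAt I x₀).symm) (extChartAt I x₀ y) (b i) := by
  obtain ⟨χ, -⟩ := (SmoothBumpFunction.nhds_basis_tsupport (I := I) x₀).ex_mem
  refine ⟨interior {y : M | χ y = 1} ∩ (extChartAt I x₀).source,
    isOpen_interior.inter (isOpen_extChartAt_source x₀),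
    ⟨mem_interior_iff_mem_nhds.2 χ.eventuallyEq_one, mem_extChartAt_source x₀⟩,
    inter_subset_right, fun i => ?_⟩
  set e := trivializationAt E (TangentSpace I : M → Type _) x₀
  refine ⟨⟨(χ : M → ℝ) • e.localFrame b i, ?_⟩, fun g hg y hy => ?_⟩
  · refine ContMDiffOn.smul_section_of_tsupport (V := (TangentSpace I : M → Type _))
      χ.contMDiff.contMDiffOn e.open_baseSet ?_ (e.contMDiffOn_localFrame_baseSet ∞ b i)
    rw [TangentBundle.trivializationAt_baseSet]
    exact χ.tsupport_subset_chartAt_source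
  · have h1 : χ y = 1 := interior_subset (s := {y : M | χ y = 1}) hy.1
    have h2 := hy.2
    rw [extChartAt_source] at h2
    rw [← derivAlong_localFrame I x₀ b i hg h2]
    change mfderiv I 𝓘(ℝ, ℂ) g y (χ y • e.localFrame b i y) = _
    rw [h1, one_smul]

end CoordinateFields

section ChartExtend

variable {E H M : Type*} [NormedAddCommGroup E] [NormedSpace ℝ E]
  [TopologicalSpace H] (I : ModelWithCorners ℝ E H) [TopologicalSpace M] [ChartedSpace H M]

/-- The function `g` in the chart at `x₀`, extended by zero. -/
noncomputable def chartExtend (x₀ : M) (g : M → ℂ) : E → ℂ :=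
  (extChartAt I x₀).target.indicator (g ∘ (extChartAt I x₀).symm)

variable {I} {x₀ : M} {g : M → ℂ}

theorem chartExtend_extChartAt {y : M} (hy : y ∈ (extChartAt I x₀).source) :
    chartExtend I x₀ g (extChartAt I x₀ y) = g y := by
  rw [chartExtend, indicator_of_mem ((extChartAt I x₀).map_source hy), Function.comp_apply,
    (extChartAt I x₀).left_inv hy]

theorem chartExtend_eq_zero {T : Set M} (hT : ∀ y ∉ T, g y = 0) {p : E}
    (hp : p ∉ extChartAt I x₀ '' T) : chartExtend I x₀ g p = 0 := by
  refine indicator_apply_eq_zero.2 fun hpt => hT _ fun hmem => hp ?_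
  exact ⟨_, hmem, (extChartAt I x₀).right_inv hpt⟩

theorem isCompact_extChartAt_image [CompactSpace M] {T : Set M} (hT : IsClosed T)
    (hs : T ⊆ (extChartAt I x₀).source) : IsCompact (extChartAt I x₀ '' T) :=
  hT.isCompact.image_of_continuousOn ((continuousOn_extChartAt x₀).mono hs)

variable [I.Boundaryless]

theorem chartExtend_eventuallyEq {p : E} (hp : p ∈ (extChartAt I x₀).target) :
    chartExtend I x₀ g =ᶠ[𝓝 p] g ∘ (extChartAt I x₀).symm := by
  filter_upwards [(isOpen_extChartAt_target x₀).mem_nhds hp] with q hq using indicator_of_mem hq _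

variable [CompactSpace M]

omit [I.Boundaryless] in
theorem chartExtend_eventuallyEq_zero (hs : tsupport g ⊆ (extChartAt I x₀).source) {p : E}
    (hp : p ∉ extChartAt I x₀ '' tsupport g) : chartExtend I x₀ g =ᶠ[𝓝 p] 0 := by
  filter_upwards [(isCompact_extChartAt_image (isClosed_tsupport g)
    hs).isClosed.isOpen_compl.mem_nhds hp] with q hq using chartExtend_eq_zero (fun y hy => image_eq_zero_of_notMem_tsupport hy) hq

omit [I.Boundaryless] in
theorem hasCompactSupport_chartExtend (hs : tsupport g ⊆ (extChartAt I x₀).source) :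
    HasCompactSupport (chartExtend I x₀ g) :=
  HasCompactSupport.intro (isCompact_extChartAt_image (isClosed_tsupport g) hs) fun _ hp =>
    chartExtend_eq_zero (fun _ hy => image_eq_zero_of_notMem_tsupport hy) hp

variable [IsManifold I ∞ M]

theorem contDiff_chartExtend (hg : ContMDiff I 𝓘(ℝ, ℂ) ∞ g)
    (hs : tsupport g ⊆ (extChartAt I x₀).source) : ContDiff ℝ ∞ (chartExtend I x₀ g) := by
  rw [contDiff_iff_contDiffAt]
  intro p
  by_cases hp : p ∈ extChartAt I x₀ '' tsupport g
  · obtain ⟨y, hy, rfl⟩ := hp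
    have ht := (extChartAt I x₀).map_source (hs hy)
    refine ContDiffAt.congr_of_eventuallyEq ?_ (chartExtend_eventuallyEq ht)
    have h := hg.comp_contMDiffOn (contMDiffOn_extChartAt_symm (I := I) (n := ∞) x₀)
    exact (contMDiffOn_iff_contDiffOn.1 h).contDiffAt ((isOpen_extChartAt_target x₀).mem_nhds ht)
  · exact contDiffAt_const.congr_of_eventuallyEq (chartExtend_eventuallyEq_zero hs hp)

omit [I.Boundaryless] [CompactSpace M] in
theorem derivAlong_eq_zero_of_notMem_tsupport (X : SmoothVectorField I M) {y : M}
    (hy : y ∉ tsupport g) : derivAlong X g y = 0 := by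
  have h : g =ᶠ[𝓝 y] fun _ => (0 : ℂ) := notMem_tsupport_iff_eventuallyEq.1 hy
  rw [derivAlong, h.mfderiv_eq, mfderiv_const]
  rfl

omit [I.Boundaryless] [CompactSpace M] in
theorem tsupport_derivAlong_subset (X : SmoothVectorField I M) :
    tsupport (derivAlong X g) ⊆ tsupport g :=
  closure_minimal (fun _ hy => by_contra fun h => hy (derivAlong_eq_zero_of_notMem_tsupport X h))
    (isClosed_tsupport g)

variable {O : Set M} {X : SmoothVectorField I M} {w : E}

theorem fderiv_chartExtend (hO : O ⊆ (extChartAt I x₀).source)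
    (hX : ∀ g : M → ℂ, ContMDiff I 𝓘(ℝ, ℂ) ∞ g → ∀ y ∈ O,
      derivAlong X g y = fderiv ℝ (g ∘ (extChartAt I x₀).symm) (extChartAt I x₀ y) w)
    (hg : ContMDiff I 𝓘(ℝ, ℂ) ∞ g) (hs : tsupport g ⊆ O) :
    (fun p => fderiv ℝ (chartExtend I x₀ g) p w) = chartExtend I x₀ (derivAlong X g) := by
  funext p
  by_cases hp : p ∈ extChartAt I x₀ '' tsupport g
  · obtain ⟨y, hy, rfl⟩ := hp
    have hy' := hO (hs hy)
    rw [chartExtend_extChartAt hy', hX g hg y (hs hy),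
      (chartExtend_eventuallyEq ((extChartAt I x₀).map_source hy')).fderiv_eq]
  · rw [(chartExtend_eventuallyEq_zero (hs.trans hO) hp).fderiv_eq,
      chartExtend_eq_zero (fun y hy => derivAlong_eq_zero_of_notMem_tsupport X hy) hp]
    simp

omit [I.Boundaryless] [CompactSpace M] in
theorem tsupport_iterate_derivAlong_subset (X : SmoothVectorField I M) (m : ℕ) :
    tsupport ((derivAlong X)^[m] g) ⊆ tsupport g := by
  induction m generalizing g with
  | zero => exact subset_rfl
  | succ m ih => exact (ih (g := derivAlong X g)).trans (tsupport_derivAlong_subset X)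

theorem iterate_fderiv_chartExtend (hO : O ⊆ (extChartAt I x₀).source)
    (hX : ∀ g : M → ℂ, ContMDiff I 𝓘(ℝ, ℂ) ∞ g → ∀ y ∈ O,
      derivAlong X g y = fderiv ℝ (g ∘ (extChartAt I x₀).symm) (extChartAt I x₀ y) w)
    (hg : ContMDiff I 𝓘(ℝ, ℂ) ∞ g) (hs : tsupport g ⊆ O) (m : ℕ) :
    (fun (f : E → ℂ) p => fderiv ℝ f p w)^[m] (chartExtend I x₀ g) =
      chartExtend I x₀ ((derivAlong X)^[m] g) := by
  induction m generalizing g with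
  | zero => rfl
  | succ m ih =>
    rw [Function.iterate_succ_apply, fderiv_chartExtend hO hX hg hs]
    exact ih (contMDiff_derivAlong X hg) ((tsupport_derivAlong_subset X).trans hs)

end ChartExtend

section Sobolev

variable {E H G : Type*} [NormedAddCommGroup E] [NormedSpace ℝ E] [FiniteDimensional ℝ E]
  [TopologicalSpace H] (I : ModelWithCorners ℝ E H) [I.Boundaryless] [TopologicalSpace G]
  [ChartedSpace H G] [Group G] [LieGroup I ∞ G] [CompactSpace G] [T2Space G]

omit [FiniteDimensional ℝ E] [I.Boundaryless] [LieGroup I ∞ G] [T2Space G] in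
variable {I} in
theorem IsLeftDiffOp.exists_sum_norm_le {ι κ : Type*} {b : ι → E}
    (s : Finset κ) (Q : κ → (G → ℂ) → G → ℂ) (hQ : ∀ k ∈ s, IsLeftDiffOp I b (Q k)) :
    ∃ (C : ℝ) (S : Finset (List ι)), 0 ≤ C ∧ ∀ f, ContMDiff I 𝓘(ℝ, ℂ) ∞ f → ∀ x,
      ∑ k ∈ s, ‖Q k f x‖ ≤ C * ∑ L ∈ S, ‖iterLeftDeriv I b L f x‖ := by
  classical
  induction s using Finset.induction_on with
  | empty => exact ⟨0, ∅, le_rfl, fun f _ x => by simp⟩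
  | insert k s hk ih =>
    obtain ⟨C, S, hC, h⟩ := ih fun j hj => hQ j (Finset.mem_insert_of_mem hj)
    obtain ⟨C', S', hC', h'⟩ := (hQ k (Finset.mem_insert_self k s)).exists_norm_le
    refine ⟨C' + C, S' ∪ S, by positivity, fun f hf x => ?_⟩
    rw [Finset.sum_insert hk, add_mul]
    refine add_le_add ((h' f hf x).trans ?_) ((h f hf x).trans ?_)
    · gcongr
      exact Finset.subset_union_left
    · gcongr
      exact Finset.subset_union_right

omit [CompactSpace G] [T2Space G] in
variable {I} in
theorem isLeftDiffOp_iterate_derivAlong {ι : Type*} [Fintype ι]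
    {b : Module.Basis ι ℝ E} {P : (G → ℂ) → G → ℂ} (X : SmoothVectorField I G) (m : ℕ)
    (hP : IsLeftDiffOp I b P) : IsLeftDiffOp I b fun f => (derivAlong X)^[m] (P f) := by
  induction m with
  | zero => exact hP
  | succ m ih =>
    refine .congr _ _ (ih.derivAlong X) fun f _ x => ?_
    rw [Function.iterate_succ_apply']

theorem exists_local_sobolev {n : ℕ} (e : EuclideanSpace ℝ (Fin n) ≃L[ℝ] E)
    (b : Module.Basis (Fin n) ℝ E) (hb : ∀ i, b i = e (EuclideanSpace.single i 1)) :
    ∃ N : Set G, IsOpen N ∧ 1 ∈ N ∧ ∃ K : Set (EuclideanSpace ℝ (Fin n)), IsCompact K ∧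
      (∀ v ∈ K, e v ∈ (extChartAt I (1 : G)).target) ∧
      ∃ (C : ℝ) (S : Finset (List (Fin n))), 0 ≤ C ∧ ∀ f : G → ℂ, ContMDiff I 𝓘(ℝ, ℂ) ∞ f →
        ∀ y ∈ N, ‖f y‖ ≤ C * ∫ v in K,
          ∑ L ∈ S, ‖iterLeftDeriv I b L f ((extChartAt I (1 : G)).symm (e v))‖ := by
  obtain ⟨O, hO, h1O, hOs, hX⟩ := exists_coordinate_vectorField I (1 : G) b
  choose X hX using hX
  obtain ⟨χ, hχO⟩ := (SmoothBumpFunction.nhds_basis_tsupport (I := I) (1 : G)).mem_iff.1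
    (hO.mem_nhds h1O)
  obtain ⟨-, hχO⟩ := (by simpa using hχO : True ∧ tsupport χ ⊆ O)
  have hχ : ContMDiff I 𝓘(ℝ, ℂ) ∞ fun x => ((χ x : ℝ) : ℂ) :=
    Complex.ofRealCLM.contMDiff.comp χ.contMDiff
  have hmul : ∀ f : G → ℂ, ContMDiff I 𝓘(ℝ, ℂ) ∞ f →
      ContMDiff I 𝓘(ℝ, ℂ) ∞ fun x => ((χ x : ℝ) : ℂ) * f x := fun f hf =>
    (contDiff_mul (𝕜 := ℝ) (𝔸 := ℂ) (n := ∞)).contMDiff.comp (hχ.prodMk_space hf)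
  have hts : ∀ f : G → ℂ, tsupport (fun x => ((χ x : ℝ) : ℂ) * f x) ⊆ tsupport χ := fun f =>
    closure_mono fun x hx h => hx (by simp [h])
  let Q : Option (Fin n) → (G → ℂ) → G → ℂ := fun k f => k.elim (fun x => ((χ x : ℝ) : ℂ) * f x)
    fun i => (derivAlong (X i))^[n + 1] fun x => ((χ x : ℝ) : ℂ) * f x
  have hQ : ∀ k, IsLeftDiffOp I b (Q k) := by
    have h0 : IsLeftDiffOp I b fun f x => ((χ x : ℝ) : ℂ) * f x := .mul _ hχ []
    rintro (_ | i)
    · exact h0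
    · exact isLeftDiffOp_iterate_derivAlong (X i) (n + 1) h0
  obtain ⟨C, S, hC, hCS⟩ := IsLeftDiffOp.exists_sum_norm_le Finset.univ Q fun k _ => hQ k
  obtain ⟨C', hC', hE⟩ := exists_norm_le_integral_fderiv e
  have hT : tsupport χ ⊆ (extChartAt I (1 : G)).source := hχO.trans hOs
  set T : Set E := extChartAt I (1 : G) '' tsupport χ
  have hTc : IsCompact T := isCompact_extChartAt_image (isClosed_tsupport _) hT
  set K : Set (EuclideanSpace ℝ (Fin n)) := e ⁻¹' T
  have hK : IsCompact K := e.toHomeomorph.isCompact_preimage.2 hTc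
  have hKt : ∀ v ∈ K, e v ∈ (extChartAt I (1 : G)).target := by
    rintro v ⟨y, hy, hv⟩
    rw [← hv]
    exact (extChartAt I (1 : G)).map_source (hT hy)
  refine ⟨interior {y : G | χ y = 1} ∩ (extChartAt I (1 : G)).source,
    isOpen_interior.inter (isOpen_extChartAt_source _),
    ⟨mem_interior_iff_mem_nhds.2 χ.eventuallyEq_one, mem_extChartAt_source _⟩, K, hK, hKt,
    C' * C, S, mul_nonneg hC' hC, fun f hf y hy => ?_⟩
  set g : G → ℂ := fun x => ((χ x : ℝ) : ℂ) * f x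
  have hg : ContMDiff I 𝓘(ℝ, ℂ) ∞ g := hmul f hf
  have hgs : tsupport g ⊆ O := (hts f).trans hχO
  have hQs : ∀ k, tsupport (Q k f) ⊆ tsupport χ := by
    rintro (_ | i)
    · exact hts f
    · exact (tsupport_iterate_derivAlong_subset (X i) _).trans (hts f)
  have hQc : ∀ k, Continuous fun v => ‖chartExtend I (1 : G) (Q k f) (e v)‖ := fun k =>
    ((contDiff_chartExtend ((hQ k).contMDiff hf) ((hQs k).trans hT)).continuous.comp
      e.continuous).norm
  have hQi : ∀ k, Integrable fun v => ‖chartExtend I (1 : G) (Q k f) (e v)‖ := fun k =>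
    (hQc k).integrable_of_hasCompactSupport
      (((hasCompactSupport_chartExtend ((hQs k).trans hT)).comp_homeomorph e.toHomeomorph).norm)
  have h1 : f y = chartExtend I (1 : G) g (extChartAt I (1 : G) y) := by
    have : χ y = 1 := interior_subset (s := {y : G | χ y = 1}) hy.1
    rw [chartExtend_extChartAt hy.2]
    simp [g, this]
  have h2 := hE _ (contDiff_chartExtend hg (hgs.trans hOs))
    (hasCompactSupport_chartExtend (hgs.trans hOs)) (extChartAt I (1 : G) y)
  have h3 : ∀ i : Fin n, (fun (f : E → ℂ) p => fderiv ℝ f p (e (EuclideanSpace.single i 1)))^[n + 1]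
      (chartExtend I (1 : G) g) = chartExtend I (1 : G) (Q (some i) f) := fun i =>
    iterate_fderiv_chartExtend hOs (fun g hg y hy => by rw [← hb]; exact hX i g hg y hy) hg hgs _
  simp only [h3] at h2
  have h4 : (∫ v, ‖chartExtend I (1 : G) g (e v)‖) +
      ∑ i, ∫ v, ‖chartExtend I (1 : G) (Q (some i) f) (e v)‖ =
      ∫ v, ∑ k, ‖chartExtend I (1 : G) (Q k f) (e v)‖ := by
    rw [integral_finsetSum _ fun k _ => hQi k, Fintype.sum_option]
    rfl
  rw [h4, ← h1] at h2
  refine h2.trans ?_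
  rw [mul_assoc]
  refine mul_le_mul_of_nonneg_left ?_ hC'
  rw [← integral_const_mul]
  have hsub : ∀ v ∉ K, ∑ k, ‖chartExtend I (1 : G) (Q k f) (e v)‖ = 0 := fun v hv =>
    Finset.sum_eq_zero fun k _ => by
      rw [chartExtend_eq_zero (fun y hy => image_eq_zero_of_notMem_tsupport
        fun h => hy (hQs k h)) hv, norm_zero]
  rw [← setIntegral_eq_integral_of_forall_compl_eq_zero hsub]
  refine setIntegral_mono_on (integrable_finsetSum _ fun k _ => hQi k).integrableOn ?_
    hK.measurableSet fun v hv => ?_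
  · have hc : ContinuousOn (fun v => (extChartAt I (1 : G)).symm (e v)) K :=
      (continuousOn_extChartAt_symm (I := I) (1 : G)).comp e.continuous.continuousOn hKt
    refine ContinuousOn.integrableOn_compact hK (continuousOn_const.mul
      (continuousOn_finsetSum _ fun L _ => ?_))
    exact ((contMDiff_iterLeftDeriv I b L hf).continuous.comp_continuousOn hc).norm
  · refine le_of_eq_of_le (Finset.sum_congr rfl fun k _ => ?_) (hCS f hf _)
    rw [chartExtend, indicator_of_mem (hKt v hv)]
    rfl

end Sobolev

section GlobalSobolev

theorem integral_setIntegral_comp_mul {G W : Type*} [TopologicalSpace G] [Group G]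
    [IsTopologicalGroup G] [CompactSpace G] [SecondCountableTopology G] [MeasurableSpace G]
    [BorelSpace G] (μ : Measure G) [IsFiniteMeasure μ] [μ.IsMulRightInvariant]
    [TopologicalSpace W] [T2Space W] [SecondCountableTopology W] [MeasurableSpace W] [BorelSpace W]
    (ν : Measure W) [SFinite ν] [IsFiniteMeasureOnCompacts ν] {K : Set W} (hK : IsCompact K)
    {ψ : W → G}
    (hψ : ContinuousOn ψ K) {h : G → ℝ} (hh : Continuous h) :
    Integrable (fun z => ∫ v in K, h (z * ψ v) ∂ν) μ ∧
      ∫ z, ∫ v in K, h (z * ψ v) ∂ν ∂μ = ν.real K * ∫ z, h z ∂μ := by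
  have : Fact (ν K < ⊤) := ⟨hK.measure_lt_top⟩
  have hi : Integrable (Function.uncurry fun z v => h (z * ψ v)) (μ.prod (ν.restrict K)) := by
    obtain ⟨C, hC⟩ := isCompact_univ.exists_bound_of_continuousOn hh.continuousOn
    refine Integrable.of_bound ?_ C (.of_forall fun p => hC _ (mem_univ _))
    have h1 := Measure.prod_restrict (μ := μ) (ν := ν) univ K
    rw [Measure.restrict_univ] at h1
    rw [h1]
    refine ContinuousOn.aestronglyMeasurable ?_ (MeasurableSet.univ.prod hK.measurableSet)
    exact hh.comp_continuousOn (continuousOn_fst.mul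
      (hψ.comp continuousOn_snd fun p hp => hp.2))
  refine ⟨hi.integral_prod_left, ?_⟩
  rw [integral_integral_swap hi]
  simp only [integral_mul_right_eq_self]
  rw [setIntegral_const, smul_eq_mul]

variable {E H G : Type*} [NormedAddCommGroup E] [NormedSpace ℝ E] [FiniteDimensional ℝ E]
  [TopologicalSpace H] (I : ModelWithCorners ℝ E H) [I.Boundaryless] [TopologicalSpace G]
  [ChartedSpace H G] [Group G] [LieGroup I ∞ G] [CompactSpace G] [T2Space G]
  [SecondCountableTopology G] [MeasurableSpace G] [BorelSpace G] (μ : Measure G)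
  [IsFiniteMeasure μ] [μ.IsMulRightInvariant] [μ.IsMulLeftInvariant] [μ.IsOpenPosMeasure]

/-- The Sobolev inequality: the supremum of a smooth function is controlled by the `L¹` norms of
its left-invariant derivatives. -/
theorem exists_norm_le_sum_integral_iterLeftDeriv :
    ∃ (n : ℕ) (b : Module.Basis (Fin n) ℝ E) (C : ℝ) (S : Finset (List (Fin n))),
      ∀ f : G → ℂ, ContMDiff I 𝓘(ℝ, ℂ) ∞ f → ∀ x,
        ‖f x‖ ≤ C * ∑ L ∈ S, ∫ y, ‖iterLeftDeriv I b L f y‖ ∂μ := by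
  have hG : IsTopologicalGroup G := topologicalGroup_of_lieGroup I ∞
  let e : EuclideanSpace ℝ (Fin (Module.finrank ℝ E)) ≃L[ℝ] E := toEuclidean.symm
  let b : Module.Basis (Fin (Module.finrank ℝ E)) ℝ E :=
    (EuclideanSpace.basisFun (Fin (Module.finrank ℝ E)) ℝ).toBasis.map e.toLinearEquiv
  obtain ⟨N, hN, h1N, K, hK, hKt, C, S, hC, hS⟩ := exists_local_sobolev (G := G) I e b fun i => by
    simp [b]
  have hψ : ContinuousOn (fun v => (extChartAt I (1 : G)).symm (e v)) K :=
    (continuousOn_extChartAt_symm (I := I) (1 : G)).comp e.continuous.continuousOn hKt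
  have hpos : 0 < μ.real N⁻¹ :=
    ENNReal.toReal_pos (hN.inv.measure_pos μ ⟨1, by simpa using h1N⟩).ne' (measure_ne_top _ _)
  have hci : ∀ {f : G → ℂ}, ContMDiff I 𝓘(ℝ, ℂ) ∞ f → ∀ L,
      Continuous fun y => ‖iterLeftDeriv I b L f y‖ := fun hf L =>
    (contMDiff_iterLeftDeriv I b L hf).continuous.norm
  have key : ∀ f : G → ℂ, ContMDiff I 𝓘(ℝ, ℂ) ∞ f →
      ‖f 1‖ ≤ (μ.real N⁻¹)⁻¹ * (C * volume.real K) *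
        ∑ L ∈ S, ∫ y, ‖iterLeftDeriv I b L f y‖ ∂μ := by
    intro f hf
    obtain ⟨hi, he⟩ := integral_setIntegral_comp_mul μ volume hK hψ
      (h := fun y => ∑ L ∈ S, ‖iterLeftDeriv I b L f y‖)
      (continuous_finsetSum _ fun L _ => hci hf L)
    rw [mul_assoc, ← div_eq_inv_mul, le_div_iff₀' hpos, mul_assoc,
      ← integral_finsetSum _ fun L _ => integrable_of_continuous_of_compactSpace μ (hci hf L), ← he,
      ← integral_const_mul, ← smul_eq_mul, ← setIntegral_const,
      ← integral_indicator hN.inv.measurableSet]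
    refine integral_mono ((integrable_const _).indicator hN.inv.measurableSet) (hi.const_mul C)
      fun z => ?_
    by_cases hz : z ∈ N⁻¹
    · rw [indicator_of_mem hz]
      have h := hS (fun y => f (z * y)) (hf.comp (contMDiff_mul_left (a := z))) z⁻¹ hz
      simpa only [iterLeftDeriv_mul_left, mul_inv_cancel] using h
    · rw [indicator_of_notMem hz]
      exact mul_nonneg hC (integral_nonneg fun v => Finset.sum_nonneg fun L _ => norm_nonneg _)
  refine ⟨Module.finrank ℝ E, b, (μ.real N⁻¹)⁻¹ * (C * volume.real K), S, fun f hf x => ?_⟩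
  have h := key (fun y => f (x * y)) (hf.comp (contMDiff_mul_left (a := x)))
  simp only [iterLeftDeriv_mul_left, mul_one] at h
  refine h.trans_eq ?_
  congr 1
  exact Finset.sum_congr rfl fun L _ =>
    integral_mul_left_eq_self (fun y => ‖iterLeftDeriv I b L f y‖) x

end GlobalSobolev

/-! ### Convergence of Fourier series of smooth functions -/

section FourierDerivatives

variable {E H G : Type*} [NormedAddCommGroup E] [NormedSpace ℝ E]
  [TopologicalSpace H] (I : ModelWithCorners ℝ E H) [I.Boundaryless] [TopologicalSpace G]
  [ChartedSpace H G] [Group G] [LieGroup I ∞ G]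

theorem leftDeriv_sub (v : E) {f g : G → ℂ} (hf : ContMDiff I 𝓘(ℝ, ℂ) ∞ f)
    (hg : ContMDiff I 𝓘(ℝ, ℂ) ∞ g) (x : G) :
    leftDeriv I v (fun y => f y - g y) x = leftDeriv I v f x - leftDeriv I v g x := by
  have h := fderiv_fun_sub (differentiableAt_comp_mul_extChartAt_symm I hf x)
    (differentiableAt_comp_mul_extChartAt_symm I hg x)
  rw [leftDeriv, h]
  rfl

theorem leftDeriv_sum (v : E) {κ : Type*} (s : Finset κ) {f : κ → G → ℂ}
    (hf : ∀ k, ContMDiff I 𝓘(ℝ, ℂ) ∞ (f k)) (x : G) :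
    leftDeriv I v (fun y => ∑ k ∈ s, f k y) x = ∑ k ∈ s, leftDeriv I v (f k) x := by
  have h := fderiv_fun_sum fun k (_ : k ∈ s) => differentiableAt_comp_mul_extChartAt_symm I (hf k) x
  rw [leftDeriv, h]
  simp [leftDeriv]

variable {I} in
theorem iterDerivAlong_sub (L : List (SmoothVectorField I G)) {f g : G → ℂ}
    (hf : ContMDiff I 𝓘(ℝ, ℂ) ∞ f) (hg : ContMDiff I 𝓘(ℝ, ℂ) ∞ g) (x : G) :
    iterDerivAlong L (fun y => f y - g y) x = iterDerivAlong L f x - iterDerivAlong L g x := by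
  induction L generalizing x with
  | nil => rfl
  | cons X L ih =>
    change derivAlong X (iterDerivAlong L fun y => f y - g y) x =
      derivAlong X (iterDerivAlong L f) x - derivAlong X (iterDerivAlong L g) x
    have hf' := contMDiff_iterDerivAlong L hf
    have hg' := contMDiff_iterDerivAlong L hg
    rw [funext ih, derivAlong_eq_leftDeriv X (hf'.sub hg'), derivAlong_eq_leftDeriv X hf',
      derivAlong_eq_leftDeriv X hg', leftDeriv_sub I _ hf' hg']

variable [FiniteDimensional ℝ E] [CompactSpace G] [T2Space G] [MeasurableSpace G] [BorelSpace G]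
  (μ : Measure G)

omit [BorelSpace G] in
theorem UnitaryIrrep.contMDiff_fourierTerm (ξ : UnitaryIrrep.{w} G) (f : G → ℂ) :
    ContMDiff I 𝓘(ℝ, ℂ) ∞ (ξ.fourierTerm μ f) := by
  let tr : (ξ.space →L[ℂ] ξ.space) →L[ℂ] ℂ := LinearMap.toContinuousLinearMap
    ((ξ.dim : ℂ) • LinearMap.trace ℂ ξ.space ∘ₗ ContinuousLinearMap.coeLM ℂ ∘ₗ
      LinearMap.mulRight ℂ (fourierCoefficient μ f ξ))
  exact (tr.restrictScalars ℝ).contMDiff.comp (ξ.contMDiff_op (I := I))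

variable [IsProbabilityMeasure μ] [μ.IsMulRightInvariant]

omit [T2Space G] in
theorem UnitaryIrrep.fourierTerm_mul_right [IsTopologicalGroup G] (ξ : UnitaryIrrep.{w} G)
    {f : G → ℂ} (hf : Continuous f) (x z : G) :
    ξ.fourierTerm μ f (x * z) = ∫ y, f (y * z) * ξ.dirichletKernel x y ∂μ := by
  rw [ξ.fourierTerm_eq_integral μ hf, ← integral_mul_right_eq_self _ z]
  refine integral_congr_ae (.of_forall fun y => ?_)
  change f (y * z) * (ξ.dim * LinearMap.trace ℂ ξ.space
    (ξ.op (x * z) * ξ.op (y * z)⁻¹).toLinearMap) = f (y * z) * (ξ.dim * LinearMap.trace ℂ ξ.space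
    (ξ.op x * ξ.op y⁻¹).toLinearMap)
  rw [← map_mul, ← map_mul]
  simp [mul_assoc]

omit [T2Space G] in
theorem UnitaryIrrep.leftDeriv_fourierTerm (ξ : UnitaryIrrep.{w} G) (v : E) {f : G → ℂ}
    (hf : ContMDiff I 𝓘(ℝ, ℂ) ∞ f) :
    leftDeriv I v (ξ.fourierTerm μ f) = ξ.fourierTerm μ (leftDeriv I v f) := by
  have := topologicalGroup_of_lieGroup I ∞ (G := G)
  funext x
  rw [leftDeriv, ξ.fourierTerm_eq_integral μ (contMDiff_leftDeriv I v hf).continuous]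
  simp_rw [ξ.fourierTerm_mul_right μ hf.continuous]
  exact fderiv_integral_comp_mul I μ v f hf _ (ξ.dirichletKernel x).continuous

variable (ρ : UnitaryDual.{w} G → UnitaryIrrep.{w} G)

theorem iterLeftDeriv_sum_fourierTerm_sub {ι : Type*} (b : ι → E) (L : List ι)
    (s : Finset (UnitaryDual.{w} G)) {f : G → ℂ} (hf : ContMDiff I 𝓘(ℝ, ℂ) ∞ f) :
    iterLeftDeriv I b L (fun x => ∑ c ∈ s, (ρ c).fourierTerm μ f x - f x) = fun x =>
      ∑ c ∈ s, (ρ c).fourierTerm μ (iterLeftDeriv I b L f) x - iterLeftDeriv I b L f x := by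
  induction L with
  | nil => rfl
  | cons i L ih =>
    have hL := contMDiff_iterLeftDeriv I b L hf
    have hP : ∀ c, ContMDiff I 𝓘(ℝ, ℂ) ∞ ((ρ c).fourierTerm μ (iterLeftDeriv I b L f)) := fun c =>
      (ρ c).contMDiff_fourierTerm I μ _
    have hs : ContMDiff I 𝓘(ℝ, ℂ) ∞
        fun x => ∑ c ∈ s, (ρ c).fourierTerm μ (iterLeftDeriv I b L f) x :=
      contMDiff_finsetSum fun c _ => hP c
    funext x
    rw [iterLeftDeriv_cons, ih, leftDeriv_sub I _ hs hL, leftDeriv_sum I _ s hP]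
    simp only [UnitaryIrrep.leftDeriv_fourierTerm I μ _ _ hL, iterLeftDeriv_cons]

variable [μ.IsMulLeftInvariant] [μ.IsOpenPosMeasure] [SecondCountableTopology G]

theorem exists_tendsto_norm_sum_fourierTerm_sub_le (hρ : ∀ c, (ρ c).toDual = c) {f : G → ℂ}
    (hf : ContMDiff I 𝓘(ℝ, ℂ) ∞ f) :
    ∃ u : Finset (UnitaryDual.{w} G) → ℝ, Filter.Tendsto u Filter.atTop (𝓝 0) ∧
      ∀ s x, ‖∑ c ∈ s, (ρ c).fourierTerm μ f x - f x‖ ≤ u s := by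
  have := topologicalGroup_of_lieGroup I ∞ (G := G)
  obtain ⟨n, b, C, S, h⟩ := exists_norm_le_sum_integral_iterLeftDeriv I μ
  have hc : ∀ L, Continuous (iterLeftDeriv I b L f) := fun L =>
    (contMDiff_iterLeftDeriv I b L hf).continuous
  let F : List (Fin n) → C(G, ℂ) := fun L => ⟨iterLeftDeriv I b L f, hc L⟩
  refine ⟨fun s => max C 0 * ∑ L ∈ S, ‖∑ c ∈ s,
    ContinuousMap.toLp 2 μ ℂ ((ρ c).fourierTerm μ (F L)) - ContinuousMap.toLp 2 μ ℂ (F L)‖, ?_, fun s x => ?_⟩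
  · have h1 : ∀ L, Filter.Tendsto (fun s : Finset (UnitaryDual.{w} G) =>
        ‖∑ c ∈ s, ContinuousMap.toLp 2 μ ℂ ((ρ c).fourierTerm μ (F L)) -
          ContinuousMap.toLp 2 μ ℂ (F L)‖) Filter.atTop (𝓝 0) := fun L => by
      have h1 : Filter.Tendsto _ _ _ := hasSum_toLp_fourierTerm μ ρ hρ (F L)
      exact tendsto_iff_norm_sub_tendsto_zero.1 h1
    simpa using (tendsto_finsetSum S fun L _ => h1 L).const_mul (max C 0)
  · have hs : ContMDiff I 𝓘(ℝ, ℂ) ∞ fun x => ∑ c ∈ s, (ρ c).fourierTerm μ f x - f x :=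
      (contMDiff_finsetSum fun c _ => (ρ c).contMDiff_fourierTerm I μ _).sub hf
    refine (h _ hs x).trans ?_
    refine mul_le_mul (le_max_left _ _) (Finset.sum_le_sum fun L _ => ?_)
      (Finset.sum_nonneg fun L _ => integral_nonneg fun y => norm_nonneg _) (le_max_right _ _)
    rw [iterLeftDeriv_sum_fourierTerm_sub I μ ρ b L s hf, ← map_sum, ← map_sub]
    refine le_of_eq_of_le (integral_congr_ae (.of_forall fun y => ?_))
      (integral_norm_le_norm_toLp μ _)
    simp only [ContinuousMap.sub_apply, ContinuousMap.sum_apply]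
    rfl

/-- The term `x ↦ dim(ξ) Tr(ξ(x) f̂(ξ))` of the Fourier series of `f`, as a smooth function. -/
noncomputable def UnitaryIrrep.smoothFourierTerm (ξ : UnitaryIrrep.{w} G) (f : G → ℂ) :
    SmoothFunction I G :=
  ⟨ξ.fourierTerm μ f, ξ.contMDiff_fourierTerm I μ f⟩

/-- The Fourier series of a smooth function converges unconditionally in `C^∞(G)`. -/
theorem hasSum_smoothFourierTerm (hρ : ∀ c, (ρ c).toDual = c) (f : SmoothFunction I G) :
    HasSum (fun c => (ρ c).smoothFourierTerm I μ f) f := by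
  have hs : ∀ s : Finset (UnitaryDual.{w} G),
      ((∑ c ∈ s, (ρ c).smoothFourierTerm I μ f : SmoothFunction I G) : G → ℂ) =
        fun x => ∑ c ∈ s, (ρ c).fourierTerm μ f x := fun s => by
    funext x
    have h := map_sum
      (ContMDiffMap.coeFnAddMonoidHom (I := I) (n := ∞) (N := G) (I' := 𝓘(ℝ, ℂ)) (G := ℂ))
      (fun c => (ρ c).smoothFourierTerm I μ f) s
    exact (congrFun h x).trans (Finset.sum_apply x s _)
  change Filter.Tendsto _ _ _
  rw [nhds_iInf, Filter.tendsto_iInf]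
  intro L
  rw [nhds_induced, Filter.tendsto_comap_iff, UniformFun.tendsto_iff_tendstoUniformly,
    Metric.tendstoUniformly_iff]
  intro ε hε
  let b := Module.finBasis ℝ E
  have h0 : IsLeftDiffOp I b fun g : G → ℂ => g :=
    .congr _ _ (.mul (fun _ => 1) contMDiff_const []) fun g _ x => (one_mul _).symm
  obtain ⟨C, S, hC, hS⟩ := (IsLeftDiffOp.iterDerivAlong b L h0).exists_norm_le
  choose u hu hus using fun K : List (Fin (Module.finrank ℝ E)) =>
    exists_tendsto_norm_sum_fourierTerm_sub_le I μ ρ hρ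
      (contMDiff_iterLeftDeriv I b K f.contMDiff)
  have hlim : Filter.Tendsto (fun s => C * ∑ K ∈ S, u K s) Filter.atTop (𝓝 0) := by
    rw [show (0 : ℝ) = C * ∑ K ∈ S, (0 : ℝ) by simp]
    exact (tendsto_finsetSum _ fun K _ => hu K).const_mul C
  filter_upwards [hlim.eventually_lt_const hε] with s hsε x
  refine lt_of_le_of_lt ?_ hsε
  have hsm : ContMDiff I 𝓘(ℝ, ℂ) ∞ fun x => ∑ c ∈ s, (ρ c).fourierTerm μ f x :=
    contMDiff_finsetSum fun c _ => (ρ c).contMDiff_fourierTerm I μ _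
  rw [dist_comm, dist_eq_norm]
  change ‖iterDerivAlong L (∑ c ∈ s, (ρ c).smoothFourierTerm I μ f : SmoothFunction I G) x -
    iterDerivAlong L f x‖ ≤ _
  rw [hs, ← iterDerivAlong_sub L hsm f.contMDiff]
  refine (hS _ (hsm.sub f.contMDiff) x).trans ?_
  gcongr with K
  rw [iterLeftDeriv_sum_fourierTerm_sub I μ ρ b K s f.contMDiff]
  exact hus K s x

end FourierDerivatives

theorem UnitaryIrrep.apply_smoothFourierTerm {E H G : Type*} [NormedAddCommGroup E]
    [NormedSpace ℝ E] [FiniteDimensional ℝ E] [TopologicalSpace H] (I : ModelWithCorners ℝ E H)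
    [I.Boundaryless] [TopologicalSpace G] [ChartedSpace H G] [Group G] [LieGroup I ∞ G]
    [CompactSpace G] [T2Space G] [MeasurableSpace G] [BorelSpace G] (μ : Measure G)
    (A : SmoothFunction I G →L[ℂ] SmoothFunction I G) (ξ : UnitaryIrrep.{w} G) (f : G → ℂ) (x : G) :
    A (ξ.smoothFourierTerm I μ f) x = (ξ.dim : ℂ) * LinearMap.trace ℂ ξ.space
      (ξ.op x * operatorSymbol A x ξ * fourierCoefficient μ f ξ).toLinearMap := by
  have h1 := (eq_rightKernelAt_iff A x _).1 rfl (ξ.smoothFourierTerm I μ f)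
  have h2 : SmoothFunction.compDiffeo (invMulDiffeo I x).symm (ξ.smoothFourierTerm I μ f) =
      (ξ.dim : ℂ) • ∑ i, ξ.adjointCoefficient I (fourierCoefficient μ f ξ (ξ.basis i))
        (ContinuousLinearMap.adjoint (ξ.op x) (ξ.basis i)) := by
    ext z
    have h := map_sum
      (ContMDiffMap.coeFnAddMonoidHom (I := I) (n := ∞) (N := G) (I' := 𝓘(ℝ, ℂ)) (G := ℂ))
      (fun i => ξ.adjointCoefficient I (fourierCoefficient μ f ξ (ξ.basis i))
        (ContinuousLinearMap.adjoint (ξ.op x) (ξ.basis i))) Finset.univ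
    rw [SmoothFunction.smul_apply]
    refine Eq.trans ?_ (congrArg _ ((congrFun h z).trans (Finset.sum_apply z _ _)).symm)
    change ξ.dim * LinearMap.trace ℂ ξ.space
      (ξ.op (x * z⁻¹) * fourierCoefficient μ f ξ).toLinearMap = _
    rw [LinearMap.trace_eq_sum_inner _ ξ.basis]
    refine congrArg _ (Finset.sum_congr rfl fun i _ => ?_)
    change _ = inner ℂ (ContinuousLinearMap.adjoint (ξ.op x) (ξ.basis i))
      (ContinuousLinearMap.adjoint (ξ.op z) (fourierCoefficient μ f ξ (ξ.basis i)))
    rw [ContinuousLinearMap.adjoint_inner_left, ξ.adjoint_op, map_mul]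
    rfl
  rw [h1, h2, map_smul, map_sum, smul_eq_mul, LinearMap.trace_eq_sum_inner _ ξ.basis]
  refine congrArg _ (Finset.sum_congr rfl fun i _ => ?_)
  rw [← inner_distFourierCoefficient, ContinuousLinearMap.adjoint_inner_left]
  rfl

theorem mainTheorem8
    {E : Type*} [NormedAddCommGroup E] [NormedSpace ℝ E] [FiniteDimensional ℝ E]
    {H : Type*} [TopologicalSpace H] (I : ModelWithCorners ℝ E H) [I.Boundaryless]
    {G : Type*} [TopologicalSpace G] [ChartedSpace H G] [Group G] [LieGroup I ∞ G]
    [CompactSpace G] [T2Space G] [MeasurableSpace G] [BorelSpace G]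
    (μ : Measure G) [μ.IsHaarMeasure] [IsProbabilityMeasure μ]
    (A : SmoothFunction I G →L[ℂ] SmoothFunction I G)
    (ρ : UnitaryDual.{w} G → UnitaryIrrep.{w} G) (hρ : ∀ c, (ρ c).toDual = c)
    (f : SmoothFunction I G) (x : G) :
    HasSum
      (fun c : UnitaryDual.{w} G => ((ρ c).dim : ℂ) *
        LinearMap.trace ℂ (ρ c).space
          ((ρ c).op x * operatorSymbol A x (ρ c) * fourierCoefficient μ f (ρ c)).toLinearMap)
      (A f x) := by
  have := topologicalGroup_of_lieGroup I ∞ (G := G)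
  have := I.secondCountableTopology
  have := ChartedSpace.secondCountable_of_sigmaCompact H G
  have := isMulRightInvariant_of_isProbabilityMeasure μ
  have h := (hasSum_smoothFourierTerm I μ ρ hρ f).mapL ((diracDistribution x).comp A)
  simp_rw [← UnitaryIrrep.apply_smoothFourierTerm]
  exact h
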